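/- All spaces are over $\mathbb R$. A quasinorm on a vector space $X$ is a map $\|\cdot\|:X\to[0,\infty)$ with $\|x\|=0$ iff $x=0$, $\|tx\|=|t|\|x\|$, and $\|x+y\|\le\Delta(\|x\|+\|y\|)$ for some constant $\Delta$; a quasi-Banach space is a complete quasinormed space. A map $f:X\to Y$ between quasinormed spaces is bounded if $\|f(x)\|\le M\|x\|$ for some $M$ and all $x$; operators are bounded linear maps. For a homogeneous map $g$ put $\|g\|=\sup_{\|x\|=1}\|g(x)\|\in[0,\infty]$. Quasilinear maps. A map $f:X\to Y$ is quasilinear if $f(tx)=tf(x)$ for all $t\in\mathbb R$, $x\in X$, and there is a constant $Q$ with $\|f(x+y)-f(x)-f(y)\|\le Q(\|x\|+\|y\|)$ for all $x,y\in X$; the least such $Q$ is denoted $Q[f]$. It is trivial if there is a (possibly unbounded) linear map $\ell:X\to Y$ with $\|f-\ell\|<\infty$. $K[X,Y]\in[0,\infty]$ is the infimum of the constants $C\ge 0$ such that for every quasilinear $f:X\to Y$ there is a linear $\ell:X\to Y$ with $\|f-\ell\|\le C\,Q[f]$; $K_0[X,Y]$ is defined in the same way using only the bounded quasilinear maps $f$.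 $X$ is a $\mathcal K$-space if $K[X,\mathbb R]<\infty$. Ultrapowers. An ultrafilter is countably incomplete if it contains countably many sets with empty intersection. If $\mathscr U$ is a countably incomplete ultrafilter on a set $I$ and $X$ is a quasinormed space, the ultrapower $X_{\mathscr U}$ is the space of families $(x_i)\in X^I$ with $\lim_{\mathscr U(i)}\|x_i\|<\infty$ modulo those with $\lim_{\mathscr U(i)}\|x_i\|=0$. The class of $(x_i)$ is denoted $(x_i)_{\mathscr U}$, and its quasinorm is $\lim_{\mathscr U(i)}\|x_i\|$ (if the quasinorm of $X$ is not continuous, the infimum of these limits over all families representing the class). A map $F:X_{\mathscr U}\to Y_{\mathscr U}$ is induced by a family of maps $f_i:X\to Y$ $(i\in I)$ if $F((x_i)_{\mathscr U})=(f_i(x_i))_{\mathscr U}$ for every $(x_i)_{\mathscr U}\in X_{\mathscr U}$. It is accessible if it is induced by some family of (arbitrary) maps $f_i:X\to Y$, and it is an ultraproduct of operators if it is induced by a family of operators $X\to Y$. A quasi-Banach space $Y$ is an ultrasummand if for each of its ultrapowers $Y_{\mathscr V}$ there is an operator $P:Y_{\mathscr V}\to Y$ with $P((y)_{\mathscr V})=y$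 for all $y\in Y$, where $(y)_{\mathscr V}$ is the class of the constant family. A quasi-Banach space $X$ has the bounded approximation property (BAP) if there is $\lambda\ge1$ such that for every finite-dimensional subspace $E\subset X$ and every $\varepsilon>0$ there is a finite-rank operator $t:X\to X$ with $\|t(x)\|\le\lambda\|x\|$ for all $x\in X$ and $\|t(x)-x\|\le\varepsilon\|x\|$ for all $x\in E$. Statement. Let $\mathscr U$ be a countably incomplete ultrafilter on a set $I$, and let $X$ and $Y$ be quasi-Banach spaces with $Y$ an ultrasummand. Suppose that either $X$ has the BAP, or $X$ is a $\mathcal K$-space and $Y$ has the BAP. Then the following statements are equivalent: 1. Every accessible operator $X_{\mathscr U}\to Y_{\mathscr U}$ is an ultraproduct of operators. 2. $K[X,Y]<\infty$. 3. $K_0[X,Y]<\infty$. 4. Every quasilinear map $X\to Y$ is trivial. 5. Every short exact sequence $0\to Y\xrightarrow{\,j\,} Z\xrightarrow{\,q\,} X\to0$ of quasi-Banach spaces and operators splits, that is, there is an operator $r:Z\to Y$ with $r\circ j=\mathbf 1_Y$. -/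

import Mathlib

open Filter Topology
open scoped ENNReal

universe u v w

/-- The function `‖·‖` is a quasinorm on the real vector space `X`. -/
class IsQuasinormed (X : Type u) [AddCommGroup X] [Module ℝ X] [Norm X] : Prop where
  nonneg : ∀ x : X, 0 ≤ ‖x‖
  eq_zero_iff : ∀ x : X, ‖x‖ = 0 ↔ x = 0
  smul : ∀ (t : ℝ) (x : X), ‖t • x‖ = |t| * ‖x‖
  add_le : ∃ Δ : ℝ, ∀ x y : X, ‖x + y‖ ≤ Δ * (‖x‖ + ‖y‖)

/-- Quasi-Banach spaces: complete quasinormed spaces. The balls of radius `1/n` are a countable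
neighbourhood base at zero, so completeness is completeness for Cauchy sequences. -/
class IsQuasiBanach (X : Type u) [AddCommGroup X] [Module ℝ X] [Norm X] : Prop
    extends IsQuasinormed X where
  complete : ∀ s : ℕ → X,
    (∀ ε : ℝ, 0 < ε → ∃ N, ∀ m n, N ≤ m → N ≤ n → ‖s m - s n‖ < ε) →
      ∃ x : X, Tendsto (fun n => ‖s n - x‖) atTop (𝓝 0)

section Maps

variable {X : Type u} {Y : Type v} [AddCommGroup X] [Module ℝ X] [Norm X]
  [AddCommGroup Y] [Module ℝ Y] [Norm Y]

/-- A (not necessarily linear) map is bounded if `‖f x‖ ≤ M ‖x‖` for some constant `M`.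
Operators are the bounded linear maps. -/
def IsBoundedMap (f : X → Y) : Prop := ∃ M : ℝ, ∀ x, ‖f x‖ ≤ M * ‖x‖

def IsHomogeneous (f : X → Y) : Prop := ∀ (t : ℝ) (x : X), f (t • x) = t • f x

/-- `‖f‖ = sup {‖f x‖ : ‖x‖ = 1}`, possibly infinite. -/
noncomputable def homNorm (f : X → Y) : ℝ≥0∞ := ⨆ (x : X) (_ : ‖x‖ = 1), ENNReal.ofReal ‖f x‖

def IsQuasilinear (f : X → Y) : Prop :=
  IsHomogeneous f ∧ ∃ Q : ℝ, ∀ x y, ‖f (x + y) - f x - f y‖ ≤ Q * (‖x‖ + ‖y‖)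

/-- The quasilinearity constant `Q[f]`. -/
noncomputable def quasilinConst (f : X → Y) : ℝ≥0∞ :=
  sInf {Q : ℝ≥0∞ | ∀ x y,
    ENNReal.ofReal ‖f (x + y) - f x - f y‖ ≤ Q * ENNReal.ofReal (‖x‖ + ‖y‖)}

/-- `f` is trivial if it is at finite distance from some (possibly unbounded) linear map. -/
def IsTrivialMap (f : X → Y) : Prop := ∃ l : X →ₗ[ℝ] Y, homNorm (fun x => f x - l x) < ⊤

variable (X Y)

/-- The approximation constant `K[X, Y]`. -/
noncomputable def approxK : ℝ≥0∞ :=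
  sInf {C : ℝ≥0∞ | ∀ f : X → Y, IsQuasilinear f →
    ∃ l : X →ₗ[ℝ] Y, homNorm (fun x => f x - l x) ≤ C * quasilinConst f}

/-- The approximation constant `K₀[X, Y]`. -/
noncomputable def approxK₀ : ℝ≥0∞ :=
  sInf {C : ℝ≥0∞ | ∀ f : X → Y, IsQuasilinear f → IsBoundedMap f →
    ∃ l : X →ₗ[ℝ] Y, homNorm (fun x => f x - l x) ≤ C * quasilinConst f}

/-- `X` is a `𝒦`-space. -/
def IsKSpace : Prop := approxK X ℝ < ⊤

/-- The bounded approximation property. -/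
def HasBAP : Prop :=
  ∃ c : ℝ, 1 ≤ c ∧ ∀ E : Submodule ℝ X, FiniteDimensional ℝ E → ∀ ε : ℝ, 0 < ε →
    ∃ t : X →ₗ[ℝ] X, FiniteDimensional ℝ (LinearMap.range t) ∧
      (∀ x, ‖t x‖ ≤ c * ‖x‖) ∧ ∀ x ∈ E, ‖t x - x‖ ≤ ε * ‖x‖

/-- Every short exact sequence `0 → Y → Z → X → 0` of quasi-Banach spaces and operators splits.
(Every such `Z` is in bijection with `Y × X`, so no generality is lost in the universe of `Z`.) -/
def EveryExtensionSplits : Prop :=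
  ∀ (Z : Type (max u v)) [AddCommGroup Z] [Module ℝ Z] [Norm Z] [IsQuasiBanach Z]
    (j : Y →ₗ[ℝ] Z) (q : Z →ₗ[ℝ] X), IsBoundedMap j → IsBoundedMap q →
    Function.Injective j → LinearMap.range j = LinearMap.ker q → Function.Surjective q →
    ∃ r : Z →ₗ[ℝ] Y, IsBoundedMap r ∧ r ∘ₗ j = LinearMap.id

end Maps

section Ultrapowers

variable {I : Type w}

def CountablyIncomplete (U : Ultrafilter I) : Prop :=
  ∃ S : ℕ → Set I, (∀ n, S n ∈ U) ∧ ⋂ n, S n = ∅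

variable (U : Ultrafilter I) (X : Type u) [AddCommGroup X] [Module ℝ X] [Norm X]
  [IsQuasinormed X]

/-- The families `(x_i)` that are finite with respect to `U`, that is `lim_U ‖x_i‖ < ∞`. -/
def finiteFamilies : Submodule ℝ (I → X) where
  carrier := {x | ∃ M : ℝ, ∀ᶠ i in (U : Filter I), ‖x i‖ ≤ M}
  zero_mem' := ⟨0, Eventually.of_forall fun _ =>
    ((IsQuasinormed.eq_zero_iff (0 : X)).2 rfl).le⟩
  add_mem' := by
    rintro x y ⟨M, hM⟩ ⟨N, hN⟩
    obtain ⟨Δ, hΔ⟩ := IsQuasinormed.add_le (X := X)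
    refine ⟨|Δ| * (M + N), ?_⟩
    filter_upwards [hM, hN] with i h1 h2
    have h3 := IsQuasinormed.nonneg (x i)
    have h4 := IsQuasinormed.nonneg (y i)
    calc ‖x i + y i‖ ≤ Δ * (‖x i‖ + ‖y i‖) := hΔ _ _
      _ ≤ |Δ| * (‖x i‖ + ‖y i‖) := mul_le_mul_of_nonneg_right (le_abs_self _) (by linarith)
      _ ≤ |Δ| * (M + N) := mul_le_mul_of_nonneg_left (by linarith) (abs_nonneg _)
  smul_mem' := by
    rintro c x ⟨M, hM⟩
    refine ⟨|c| * M, ?_⟩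
    filter_upwards [hM] with i h1
    have h2 := IsQuasinormed.smul c (x i)
    simpa [h2] using mul_le_mul_of_nonneg_left h1 (abs_nonneg c)

/-- The families `(x_i)` that are infinitesimal with respect to `U`, that is
`lim_U ‖x_i‖ = 0`. -/
def infinitesimalFamilies : Submodule ℝ (I → X) where
  carrier := {x | Tendsto (fun i => ‖x i‖) (U : Filter I) (𝓝 0)}
  zero_mem' := by
    have h : ‖(0 : X)‖ = 0 := (IsQuasinormed.eq_zero_iff (0 : X)).2 rfl
    simp [h]
  add_mem' := by
    intro x y hx hy
    obtain ⟨Δ, hΔ⟩ := IsQuasinormed.add_le (X := X)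
    have h : Tendsto (fun i => Δ * (‖x i‖ + ‖y i‖)) (U : Filter I) (𝓝 0) := by
      simpa using (Tendsto.add hx hy).const_mul Δ
    exact squeeze_zero (fun i => IsQuasinormed.nonneg _) (fun i => hΔ _ _) h
  smul_mem' := by
    intro c x hx
    have h : Tendsto (fun i => |c| * ‖x i‖) (U : Filter I) (𝓝 0) := by
      simpa using Tendsto.const_mul |c| hx
    refine h.congr fun i => ?_
    exact (IsQuasinormed.smul c (x i)).symm

/-- The ultrapower `X_U`: finite families modulo infinitesimal ones. -/
def Ultrapower : Type (max u w) :=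
  finiteFamilies U X ⧸ (infinitesimalFamilies U X).submoduleOf (finiteFamilies U X)

instance : AddCommGroup (Ultrapower U X) :=
  inferInstanceAs (AddCommGroup
    (finiteFamilies U X ⧸ (infinitesimalFamilies U X).submoduleOf (finiteFamilies U X)))

instance : Module ℝ (Ultrapower U X) :=
  inferInstanceAs (Module ℝ
    (finiteFamilies U X ⧸ (infinitesimalFamilies U X).submoduleOf (finiteFamilies U X)))

/-- The class `(x_i)_U` of a finite family, as a linear map. -/
def Ultrapower.mk : finiteFamilies U X →ₗ[ℝ] Ultrapower U X :=
  ((infinitesimalFamilies U X).submoduleOf (finiteFamilies U X)).mkQ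

/-- The quasinorm of the ultrapower, `‖(x_i)_U‖ = lim_U ‖x_i‖`. When the quasinorm of `X` is
continuous (for instance a `p`-norm) this limit does not depend on the representative; in
general one takes the infimum over the representatives, which is the quotient quasinorm. -/
noncomputable instance : Norm (Ultrapower U X) where
  norm z := sInf {r : ℝ | ∃ x : finiteFamilies U X,
    Ultrapower.mk U X x = z ∧ Tendsto (fun i => ‖x.1 i‖) (U : Filter I) (𝓝 r)}

/-- The diagonal embedding `X → X_U`. -/
def Ultrapower.diag : X →ₗ[ℝ] Ultrapower U X :=
  Ultrapower.mk U X ∘ₗ LinearMap.codRestrict (finiteFamilies U X)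
    (LinearMap.pi fun _ : I => (LinearMap.id : X →ₗ[ℝ] X))
    (fun x => ⟨‖x‖, Eventually.of_forall fun _ => le_rfl⟩)

/-- `X` is an ultrasummand: it is complemented in all its ultrapowers through the diagonal
embedding (ultrapowers are taken with respect to countably incomplete ultrafilters). -/
def IsUltrasummand : Prop :=
  ∀ (J : Type u) (V : Ultrafilter J), CountablyIncomplete V →
    ∃ P : Ultrapower V X →ₗ[ℝ] X, IsBoundedMap P ∧ P ∘ₗ Ultrapower.diag V X = LinearMap.id

variable {U X} {Y : Type v} [AddCommGroup Y] [Module ℝ Y] [Norm Y] [IsQuasinormed Y]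

/-- `F = (f_i)_U`: for every finite family `(x_i)` the family `(f_i(x_i))` is finite and
`F((x_i)_U) = (f_i(x_i))_U`. -/
def IsInducedBy (F : Ultrapower U X → Ultrapower U Y) (f : I → X → Y) : Prop :=
  ∀ x : finiteFamilies U X, ∃ h : (fun i => f i (x.1 i)) ∈ finiteFamilies U Y,
    F (Ultrapower.mk U X x) = Ultrapower.mk U Y ⟨fun i => f i (x.1 i), h⟩

/-- Accessible maps: those induced by an (admissible) family of arbitrary maps. -/
def IsAccessible (F : Ultrapower U X → Ultrapower U Y) : Prop :=
  ∃ f : I → X → Y, IsInducedBy F f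

/-- `F` is an ultraproduct of operators `X → Y`. -/
def IsUltraproductOfOperators (F : Ultrapower U X → Ultrapower U Y) : Prop :=
  ∃ t : I → X →ₗ[ℝ] Y, (∀ i, IsBoundedMap (t i)) ∧ IsInducedBy F (fun i => t i)

end Ultrapowers

/-! The hub is the finiteness of `approxK₀`. An accessible operator between ultrapowers is the same
thing as a uniformly bounded, asymptotically linear family: it can be induced by homogeneous maps
that are bounded by one constant for almost all indices and whose additivity defects tend to zero
(`exists_homogeneous_inducing`, `exists_eventually_bound`, `eventually_defectLE`). Conversely, any
such family induces an operator (`exists_operator_of_asymptotically_linear`). If bounded quasilinear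
maps are uniformly approximable, each inducing map can be replaced by a linear one at distance
tending to zero, which does not change the operator. If they are not, rescaling the bad maps by
their distance to the linear maps gives bounded maps with small defect that stay away from every
linear map. Countable incompleteness strings them along the index set into an accessible operator
that no family of linear maps induces.

An ultrasummand target makes linear approximation a finite matter
(`IsUltrasummand.exists_linear_approx`): linear maps close to `f` on each finite set are glued in an
ultrapower of `Y` and projected back. So `approxK` is finite once `approxK₀` is: on a finite set `f`
coincides with `f ∘ t` or `t ∘ f`, where `t` is a finite-rank operator of controlled size, and these
maps are bounded, the second after subtracting a linear map provided by the `𝒦`-space hypothesis.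

That triviality of all quasilinear maps forces a uniform constant is a Baire argument
(`approxK_lt_top_of_isTrivialMap`). Bad maps `g n` with geometrically small defect, normalized to
vanish on a Hamel basis, can be summed pointwise along every subset of `ℕ`. All the sums are
trivial, so Baire's theorem in the Cantor space gives one constant and two subsets that differ only
at `n` as far as one looks. Subtracting the two sums approximates `g n` by linear maps on finite
sets with a constant independent of `n`.

Finally, extensions correspond to quasilinear maps: a quasilinear map defines a twisted sum, and an
extension yields the composition of an algebraic retraction with a bounded homogeneous section. The
sections come from an open mapping theorem proved by the same Cantor space device. -/

set_option linter.unusedSectionVars false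

open IsQuasinormed

/-! ### Quasinorm estimates and sequential convergence. -/

section Basic

variable {X : Type u} [AddCommGroup X] [Module ℝ X] [Norm X] [IsQuasinormed X]

namespace IsQuasinormed

theorem norm_zero' : ‖(0 : X)‖ = 0 := (eq_zero_iff (0 : X)).2 rfl

theorem norm_neg' (x : X) : ‖-x‖ = ‖x‖ := by
  simpa using smul (-1) x

theorem norm_sub_comm (x y : X) : ‖x - y‖ = ‖y - x‖ := by
  rw [← norm_neg' (x - y), neg_sub]

variable (X) in
/-- The modulus of concavity can be taken at least one. -/
theorem exists_modulus : ∃ Δ : ℝ, 1 ≤ Δ ∧ ∀ x y : X, ‖x + y‖ ≤ Δ * (‖x‖ + ‖y‖) := by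
  obtain ⟨Δ, hΔ⟩ := add_le (X := X)
  refine ⟨max 1 Δ, le_max_left _ _, fun x y => (hΔ x y).trans ?_⟩
  exact mul_le_mul_of_nonneg_right (le_max_right _ _) (add_nonneg (nonneg x) (nonneg y))

theorem sub_le_of_modulus {Δ : ℝ} (hΔ : ∀ x y : X, ‖x + y‖ ≤ Δ * (‖x‖ + ‖y‖)) (x y : X) :
    ‖x - y‖ ≤ Δ * (‖x‖ + ‖y‖) := by
  simpa [sub_eq_add_neg, norm_neg'] using hΔ x (-y)

theorem norm_pos {x : X} (hx : x ≠ 0) : 0 < ‖x‖ :=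
  lt_of_le_of_ne (nonneg x) fun h => hx ((eq_zero_iff x).1 h.symm)

theorem eq_zero_of_norm_nonpos {x : X} (hx : ‖x‖ ≤ 0) : x = 0 :=
  (eq_zero_iff x).1 (le_antisymm hx (nonneg x))

/-- Every vector is a multiple of its normalization. -/
theorem norm_inv_smul {x : X} (hx : x ≠ 0) : ‖(‖x‖⁻¹ • x)‖ = 1 := by
  have h := norm_pos hx
  rw [smul, abs_of_pos (inv_pos.2 h), inv_mul_cancel₀ h.ne']

/-- Splitting off the first summand each time, the term of index `k` has paid the modulus at most `k
+ 1` times. Hence ratio `1 / (2 Δ)` is the natural one for convergence of series. -/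
theorem norm_sum_range_le {Δ : ℝ} (h1 : 1 ≤ Δ)
    (hΔ : ∀ x y : X, ‖x + y‖ ≤ Δ * (‖x‖ + ‖y‖)) (n : ℕ) (x : ℕ → X) :
    ‖∑ k ∈ Finset.range n, x k‖ ≤ ∑ k ∈ Finset.range n, Δ ^ (k + 1) * ‖x k‖ := by
  induction n generalizing x with
  | zero => simp [norm_zero']
  | succ n ih =>
    rw [Finset.sum_range_succ', Finset.sum_range_succ', add_comm]
    refine (hΔ _ _).trans ?_
    have h := mul_le_mul_of_nonneg_left (ih fun k => x (k + 1)) (by linarith : 0 ≤ Δ)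
    rw [Finset.mul_sum] at h
    have h' : ∀ k, Δ * (Δ ^ (k + 1) * ‖x (k + 1)‖) = Δ ^ (k + 1 + 1) * ‖x (k + 1)‖ := by
      intro k; ring
    simp only [h'] at h
    rw [zero_add, pow_one]
    linarith [mul_add Δ ‖x 0‖ ‖∑ k ∈ Finset.range n, x (k + 1)‖]

/-- Geometric domination with ratio `1 / (2 Δ)` controls finite sums. -/
theorem norm_sum_range_le_of_geometric {Δ : ℝ} (h1 : 1 ≤ Δ)
    (hΔ : ∀ x y : X, ‖x + y‖ ≤ Δ * (‖x‖ + ‖y‖)) (n : ℕ) (x : ℕ → X) {M : ℝ} (hM : 0 ≤ M)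
    (hx : ∀ k, ‖x k‖ ≤ M * (2 * Δ)⁻¹ ^ k) :
    ‖∑ k ∈ Finset.range n, x k‖ ≤ 2 * Δ * M := by
  have h0 : 0 < Δ := by linarith
  refine (norm_sum_range_le h1 hΔ n x).trans ?_
  have h : ∀ k ∈ Finset.range n, Δ ^ (k + 1) * ‖x k‖ ≤ Δ * M * (1 / 2) ^ k := by
    intro k _
    refine (mul_le_mul_of_nonneg_left (hx k) (by positivity)).trans (le_of_eq ?_)
    rw [mul_inv, mul_pow, pow_succ, inv_pow, inv_pow, one_div, inv_pow]
    field_simp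
  refine (Finset.sum_le_sum h).trans ?_
  rw [← Finset.mul_sum]
  have h2 := sum_geometric_two_le n
  nlinarith [mul_nonneg h0.le hM]

theorem norm_sum_Ico_le_of_geometric {Δ : ℝ} (h1 : 1 ≤ Δ)
    (hΔ : ∀ x y : X, ‖x + y‖ ≤ Δ * (‖x‖ + ‖y‖)) {m n : ℕ} (hmn : m ≤ n) (x : ℕ → X) {M : ℝ}
    (hM : 0 ≤ M) (hx : ∀ k, ‖x k‖ ≤ M * (2 * Δ)⁻¹ ^ k) :
    ‖∑ k ∈ Finset.range n, x k - ∑ k ∈ Finset.range m, x k‖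
      ≤ 2 * Δ * (M * (2 * Δ)⁻¹ ^ m) := by
  rw [← Finset.sum_Ico_eq_sub _ hmn, Finset.sum_Ico_eq_sum_range]
  refine norm_sum_range_le_of_geometric h1 hΔ _ _ (by positivity) fun k => ?_
  refine (hx _).trans (le_of_eq ?_)
  rw [pow_add]; ring

end IsQuasinormed

instance : IsQuasinormed ℝ where
  nonneg := norm_nonneg
  eq_zero_iff _ := norm_eq_zero
  smul t x := by simp
  add_le := ⟨1, fun x y => by simpa using abs_add_le x y⟩

/-- Convergence of a sequence for the quasinorm. -/
def QTendsto (s : ℕ → X) (x : X) : Prop := Tendsto (fun n => ‖s n - x‖) atTop (𝓝 0)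

namespace QTendsto

theorem const (x : X) : QTendsto (fun _ => x) x := by
  simp [QTendsto, norm_zero']

theorem add {s t : ℕ → X} {x y : X} (hs : QTendsto s x) (ht : QTendsto t y) :
    QTendsto (fun n => s n + t n) (x + y) := by
  obtain ⟨Δ, h1, hΔ⟩ := exists_modulus X
  have h : Tendsto (fun n => Δ * (‖s n - x‖ + ‖t n - y‖)) atTop (𝓝 0) := by
    simpa using (Tendsto.add hs ht).const_mul Δ
  refine squeeze_zero (fun _ => IsQuasinormed.nonneg _) (fun n => ?_) h
  simpa [add_sub_add_comm] using hΔ (s n - x) (t n - y)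

theorem map {Y : Type v} [AddCommGroup Y] [Module ℝ Y] [Norm Y] [IsQuasinormed Y]
    {s : ℕ → X} {x : X} (hs : QTendsto s x) (f : X →ₗ[ℝ] Y) (hf : IsBoundedMap f) :
    QTendsto (fun n => f (s n)) (f x) := by
  obtain ⟨M, hM⟩ := hf
  have h : Tendsto (fun n => M * ‖s n - x‖) atTop (𝓝 0) := by
    simpa using Tendsto.const_mul M hs
  refine squeeze_zero (fun _ => IsQuasinormed.nonneg _) (fun n => ?_) h
  simpa using hM (s n - x)

theorem smul {s : ℕ → X} {x : X} (hs : QTendsto s x) (t : ℝ) :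
    QTendsto (fun n => t • s n) (t • x) := by
  have h : Tendsto (fun n => |t| * ‖s n - x‖) atTop (𝓝 0) := by
    simpa using Tendsto.const_mul |t| hs
  refine h.congr fun n => ?_
  rw [← smul_sub, IsQuasinormed.smul]

theorem sub {s t : ℕ → X} {x y : X} (hs : QTendsto s x) (ht : QTendsto t y) :
    QTendsto (fun n => s n - t n) (x - y) := by
  simpa [sub_eq_add_neg] using hs.add (ht.smul (-1))

/-- A quasinorm is lower semicontinuous up to its modulus of concavity. -/
theorem norm_le {Δ : ℝ} (h1 : 1 ≤ Δ) (hΔ : ∀ x y : X, ‖x + y‖ ≤ Δ * (‖x‖ + ‖y‖))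
    {s : ℕ → X} {x : X} (hs : QTendsto s x) {M : ℝ} (hM : ∀ᶠ n in atTop, ‖s n‖ ≤ M) :
    ‖x‖ ≤ Δ * M := by
  have h : Tendsto (fun n => Δ * (M + ‖s n - x‖)) atTop (𝓝 (Δ * M)) := by
    simpa using (Tendsto.const_add M hs).const_mul Δ
  refine ge_of_tendsto h ?_
  filter_upwards [hM] with n hn
  calc ‖x‖ = ‖s n - (s n - x)‖ := by simp
    _ ≤ Δ * (‖s n‖ + ‖s n - x‖) := sub_le_of_modulus hΔ _ _
    _ ≤ _ := mul_le_mul_of_nonneg_left (by linarith) (by linarith)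

theorem unique {s : ℕ → X} {x y : X} (hx : QTendsto s x) (hy : QTendsto s y) : x = y := by
  obtain ⟨Δ, h1, hΔ⟩ := exists_modulus X
  have h := (hx.sub hy).norm_le h1 hΔ (M := 0)
    (Eventually.of_forall fun n => by simp [norm_zero'])
  exact sub_eq_zero.1 (eq_zero_of_norm_nonpos (by simpa using h))

theorem congr_eventually {s t : ℕ → X} {x : X} (hs : QTendsto s x)
    (h : ∀ᶠ n in atTop, s n = t n) : QTendsto t x :=
  Tendsto.congr' (h.mono fun n hn => by rw [hn]) hs

end QTendsto

end Basic

section Series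

variable {X : Type u} [AddCommGroup X] [Module ℝ X] [Norm X] [IsQuasiBanach X]

/-- Geometrically dominated series converge in a quasi-Banach space. -/
theorem exists_qTendsto_sum {Δ : ℝ} (h1 : 1 ≤ Δ)
    (hΔ : ∀ x y : X, ‖x + y‖ ≤ Δ * (‖x‖ + ‖y‖)) (x : ℕ → X) {M : ℝ}
    (hM : 0 ≤ M) (hx : ∀ k, ‖x k‖ ≤ M * (2 * Δ)⁻¹ ^ k) :
    ∃ s : X, QTendsto (fun n => ∑ k ∈ Finset.range n, x k) s ∧
      ∀ m, ‖s - ∑ k ∈ Finset.range m, x k‖ ≤ Δ * (2 * Δ * (M * (2 * Δ)⁻¹ ^ m)) := by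
  have hlim : Tendsto (fun m : ℕ => 2 * Δ * (M * (2 * Δ)⁻¹ ^ m)) atTop (𝓝 0) := by
    have : Tendsto (fun m : ℕ => (2 * Δ)⁻¹ ^ m) atTop (𝓝 0) :=
      tendsto_pow_atTop_nhds_zero_of_lt_one (by positivity)
        (inv_lt_one_of_one_lt₀ (by linarith))
    simpa using (this.const_mul M).const_mul (2 * Δ)
  have hcauchy : ∀ ε : ℝ, 0 < ε → ∃ N, ∀ m n, N ≤ m → N ≤ n →
      ‖∑ k ∈ Finset.range m, x k - ∑ k ∈ Finset.range n, x k‖ < ε := by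
    intro ε hε
    obtain ⟨N, hN⟩ := (hlim.eventually_lt_const hε).exists_forall_of_atTop
    refine ⟨N, fun m n hm hn => ?_⟩
    rcases le_total n m with h | h
    · exact (norm_sum_Ico_le_of_geometric h1 hΔ h x hM hx).trans_lt (hN n hn)
    · rw [IsQuasinormed.norm_sub_comm]
      exact (norm_sum_Ico_le_of_geometric h1 hΔ h x hM hx).trans_lt (hN m hm)
  obtain ⟨s, hs⟩ := IsQuasiBanach.complete _ hcauchy
  refine ⟨s, hs, fun m => ?_⟩
  have h := QTendsto.sub (s := fun n => ∑ k ∈ Finset.range n, x k) hs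
    (QTendsto.const (∑ k ∈ Finset.range m, x k))
  refine h.norm_le h1 hΔ ?_
  filter_upwards [eventually_ge_atTop m] with n hn
  exact norm_sum_Ico_le_of_geometric h1 hΔ hn x hM hx

end Series

/-! ### Baire's theorem and subseries. -/

section CantorSpace

/-- Baire's theorem in the Cantor space: if countably many sets cover it, one of them contains
points that differ at any prescribed far coordinate and agree at as many others as wanted. -/
theorem exists_pair_differing_at (A : ℕ → Set (ℕ → Bool)) (hA : ∀ c, ∃ N, c ∈ A N) :
    ∃ N n₀ : ℕ, ∀ n, n₀ ≤ n → ∀ m, ∃ c ∈ A N, ∃ c' ∈ A N, c n = true ∧ c' n = false ∧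
      ∀ k, k < m → k ≠ n → c k = c' k := by
  have hcover : ⋃ N, closure (A N) = Set.univ := by
    refine Set.eq_univ_of_forall fun c => ?_
    obtain ⟨N, hN⟩ := hA c
    exact Set.mem_iUnion.2 ⟨N, subset_closure hN⟩
  obtain ⟨N, a, ha⟩ := nonempty_interior_of_iUnion_of_closed (fun N => isClosed_closure) hcover
  obtain ⟨v, ⟨a', n₀, rfl⟩, hav, hv⟩ :=
    (PiNat.isTopologicalBasis_cylinders fun _ : ℕ => Bool).exists_subset_of_mem_open ha
      isOpen_interior
  refine ⟨N, n₀, fun n hn m => ?_⟩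
  have key : ∀ b : Bool, ∃ c ∈ A N, c n = b ∧ ∀ k, k < m → k ≠ n → c k = a' k := by
    intro b
    -- Since `n₀ ≤ n`, altering coordinate `n` does not leave the cylinder contained in the closure.
    have hmem : Function.update a' n b ∈ closure (A N) := by
      refine interior_subset (hv ?_)
      rw [PiNat.mem_cylinder_iff]
      intro i hi
      exact Function.update_of_ne (by omega) _ _
    -- The length `max m (n + 1)` fixes the first `m` coordinates and also coordinate `n`.
    obtain ⟨c, hc, hcA⟩ := mem_closure_iff.1 hmem _
      (PiNat.isOpen_cylinder _ (Function.update a' n b) (max m (n + 1)))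
      (PiNat.self_mem_cylinder _ _)
    rw [PiNat.mem_cylinder_iff] at hc
    refine ⟨c, hcA, ?_, fun k hk hkn => ?_⟩
    · rw [hc n (by omega), Function.update_self]
    · rw [hc k (by omega), Function.update_of_ne hkn]
  obtain ⟨c, hc, h1, h2⟩ := key true
  obtain ⟨c', hc', h1', h2'⟩ := key false
  exact ⟨c, hc, c', hc', h1, h1', fun k hk hkn => (h2 k hk hkn).trans (h2' k hk hkn).symm⟩

variable {X : Type u} [AddCommGroup X] [Module ℝ X] [Norm X]

/-- The term of index `k` of the subseries of `∑ x k` selected by `c`. -/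
def subterm (c : ℕ → Bool) (x : ℕ → X) (k : ℕ) : X := if c k then x k else 0

theorem norm_subterm_le [IsQuasinormed X] (c : ℕ → Bool) (x : ℕ → X) (k : ℕ) :
    ‖subterm c x k‖ ≤ ‖x k‖ := by
  unfold subterm
  split_ifs
  · exact le_rfl
  · rw [norm_zero']; exact IsQuasinormed.nonneg _

theorem sum_subterm_sub_sum_subterm (x : ℕ → X) {c c' : ℕ → Bool} {n m : ℕ} (hnm : n < m)
    (hc : c n = true) (hc' : c' n = false) (h : ∀ k, k < m → k ≠ n → c k = c' k) :
    ∑ k ∈ Finset.range m, subterm c x k - ∑ k ∈ Finset.range m, subterm c' x k = x n := by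
  rw [← Finset.sum_sub_distrib, Finset.sum_eq_single n]
  · simp [subterm, hc, hc']
  · intro k hk hkn
    simp [subterm, h k (Finset.mem_range.1 hk) hkn]
  · intro hn
    exact absurd (Finset.mem_range.2 hnm) hn

/-- The partial sums of length `m` differ by exactly `x n`, so only the two tails contribute to the
error. -/
theorem norm_sub_subseries_le [IsQuasinormed X] {Δ : ℝ} (h1 : 1 ≤ Δ)
    (hΔ : ∀ x y : X, ‖x + y‖ ≤ Δ * (‖x‖ + ‖y‖)) {x : ℕ → X} {r : ℝ} {c c' : ℕ → Bool}
    {s s' : X} {n m : ℕ} (hs : ‖s - ∑ k ∈ Finset.range m, subterm c x k‖ ≤ r)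
    (hs' : ‖s' - ∑ k ∈ Finset.range m, subterm c' x k‖ ≤ r) (hnm : n < m)
    (hc : c n = true) (hc' : c' n = false) (h : ∀ k, k < m → k ≠ n → c k = c' k) :
    ‖x n - (s - s')‖ ≤ Δ * (r + r) := by
  have e : x n - (s - s') = (s' - ∑ k ∈ Finset.range m, subterm c' x k)
      - (s - ∑ k ∈ Finset.range m, subterm c x k) := by
    rw [← sum_subterm_sub_sum_subterm x hnm hc hc' h]; abel
  rw [e]
  exact (sub_le_of_modulus hΔ _ _).trans
    (mul_le_mul_of_nonneg_left (add_le_add hs' hs) (by linarith))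

end CantorSpace

/-! ### The open mapping theorem. -/

section OpenMapping

variable {Z : Type u} {X : Type v} [AddCommGroup Z] [Module ℝ Z] [Norm Z]
  [AddCommGroup X] [Module ℝ X] [Norm X]

/-- A submodule is sequentially closed for the quasinorm. -/
def IsQClosed (W : Submodule ℝ X) : Prop :=
  ∀ (s : ℕ → X) (x : X), (∀ n, s n ∈ W) → QTendsto s x → x ∈ W

/-- Otherwise there are `x n` in the range, of size `ρ ^ n`, that no image of a vector of norm at
most `n` approximates. All their subseries converge in the closed range. Baire gives two sums with
preimages of norm at most `N` whose difference is nearly `x n`, a contradiction for large `n`. -/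
theorem exists_approximate_preimage [IsQuasinormed Z] [IsQuasiBanach X] (A : Z →ₗ[ℝ] X)
    (hcl : IsQClosed (LinearMap.range A)) {ε : ℝ} (hε : 0 < ε) :
    ∃ C : ℝ, 0 ≤ C ∧ ∀ x ∈ LinearMap.range A, ∃ z, ‖z‖ ≤ C * ‖x‖ ∧ ‖x - A z‖ ≤ ε * ‖x‖ := by
  by_contra! hcon
  obtain ⟨Δ, h1, hΔ⟩ := exists_modulus X
  obtain ⟨Γ, hΓ1, hΓ⟩ := exists_modulus Z
  set ρ : ℝ := (2 * Δ)⁻¹ with hρ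
  have hρ0 : 0 < ρ := by positivity
  have hx : ∀ n : ℕ, ∃ x ∈ LinearMap.range A, ‖x‖ = ρ ^ n ∧
      ∀ z, ‖z‖ ≤ n → ε * ρ ^ n < ‖x - A z‖ := by
    intro n
    obtain ⟨x, hxr, hx⟩ := hcon (n * (ρ ^ n)⁻¹) (by positivity)
    have hx0 : x ≠ 0 := by
      rintro rfl
      simpa [norm_zero'] using hx 0
    have hpos := norm_pos hx0
    set t : ℝ := ρ ^ n * ‖x‖⁻¹ with ht
    have ht0 : 0 < t := by positivity
    refine ⟨t • x, Submodule.smul_mem _ _ hxr, ?_, fun z hz => ?_⟩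
    · rw [IsQuasinormed.smul, abs_of_pos ht0, ht]; field_simp
    · have h := hx (t⁻¹ • z) (by
        rw [IsQuasinormed.smul, abs_of_pos (inv_pos.2 ht0), ht]
        rw [mul_inv, inv_inv]
        calc (ρ ^ n)⁻¹ * ‖x‖ * ‖z‖ ≤ (ρ ^ n)⁻¹ * ‖x‖ * n :=
              mul_le_mul_of_nonneg_left hz (by positivity)
          _ = _ := by ring)
      have e : t • x - A z = t • (x - A (t⁻¹ • z)) := by
        rw [smul_sub, map_smul, smul_inv_smul₀ ht0.ne']
      rw [e, IsQuasinormed.smul, abs_of_pos ht0]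
      calc ε * ρ ^ n = t * (ε * ‖x‖) := by rw [ht]; field_simp
        _ < _ := mul_lt_mul_of_pos_left h ht0
  choose x hxr hxn hxz using hx
  have hsum : ∀ c : ℕ → Bool, ∃ s : X,
      QTendsto (fun n => ∑ k ∈ Finset.range n, subterm c x k) s ∧
      ∀ m, ‖s - ∑ k ∈ Finset.range m, subterm c x k‖ ≤ Δ * (2 * Δ * (1 * ρ ^ m)) := by
    intro c
    refine exists_qTendsto_sum h1 hΔ _ zero_le_one fun k => ?_
    rw [one_mul, ← hρ, ← hxn k]
    exact norm_subterm_le c x k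
  choose s hs hsm using hsum
  have hmem : ∀ c, s c ∈ LinearMap.range A := by
    intro c
    refine hcl _ _ (fun n => Submodule.sum_mem _ fun k _ => ?_) (hs c)
    unfold subterm
    split_ifs
    · exact hxr k
    · exact zero_mem _
  obtain ⟨N, n₀, hN⟩ := exists_pair_differing_at
    (fun N => {c | ∃ z, ‖z‖ ≤ N ∧ A z = s c}) (by
      intro c
      obtain ⟨z, hz⟩ := hmem c
      obtain ⟨N, hN⟩ := exists_nat_ge ‖z‖
      exact ⟨N, z, hN, hz⟩)
  -- This makes the difference of two preimages of norm at most `N` an excluded approximant of `x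
  -- n`.
  obtain ⟨n₁, hn₁⟩ := exists_nat_ge (Γ * (N + N))
  set n := max n₀ n₁
  have hlim : Tendsto (fun m : ℕ => Δ * (Δ * (2 * Δ * (1 * ρ ^ m)) + Δ * (2 * Δ * (1 * ρ ^ m))))
      atTop (𝓝 0) := by
    have : Tendsto (fun m : ℕ => ρ ^ m) atTop (𝓝 0) :=
      tendsto_pow_atTop_nhds_zero_of_lt_one hρ0.le (inv_lt_one_of_one_lt₀ (by linarith))
    have h := (((this.const_mul 1).const_mul (2 * Δ)).const_mul Δ)
    simpa using (h.add h).const_mul Δ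
  obtain ⟨m, hm1, hm2⟩ := ((hlim.eventually_lt_const (by positivity : 0 < ε * ρ ^ n)).and
    (eventually_gt_atTop n)).exists
  obtain ⟨c, ⟨z, hz, hzc⟩, c', ⟨z', hz', hzc'⟩, hcn, hcn', hk⟩ := hN n (le_max_left _ _) m
  have h := norm_sub_subseries_le h1 hΔ (hsm c m) (hsm c' m) hm2 hcn hcn' hk
  rw [← hzc, ← hzc', ← map_sub] at h
  refine absurd (hxz n (z - z') ?_) (not_lt.2 (h.trans hm1.le))
  calc ‖z - z'‖ ≤ Γ * (‖z‖ + ‖z'‖) := sub_le_of_modulus hΓ _ _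
    _ ≤ Γ * (N + N) := mul_le_mul_of_nonneg_left (add_le_add hz hz') (by linarith)
    _ ≤ n₁ := hn₁
    _ ≤ n := by exact_mod_cast le_max_right _ _

/-- The open mapping theorem for operators with closed range between quasi-Banach spaces. -/
theorem exists_bounded_preimage [IsQuasiBanach Z] [IsQuasiBanach X] (A : Z →ₗ[ℝ] X)
    (hA : IsBoundedMap A) (hcl : IsQClosed (LinearMap.range A)) :
    ∃ C : ℝ, 0 ≤ C ∧ ∀ x ∈ LinearMap.range A, ∃ z, A z = x ∧ ‖z‖ ≤ C * ‖x‖ := by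
  obtain ⟨Δ, h1, hΔ⟩ := exists_modulus Z
  set ρ : ℝ := (2 * Δ)⁻¹ with hρ
  have hρ0 : 0 < ρ := by positivity
  obtain ⟨C, hC, hz⟩ := exists_approximate_preimage A hcl hρ0
  choose! φ hφ1 hφ2 using hz
  refine ⟨Δ * (2 * Δ * C), by positivity, fun x hx => ?_⟩
  -- Residuals of successive approximation. Each is at most `ρ` times the previous one, so the
  -- corrections `φ (y k)` sum to an exact preimage.
  let y : ℕ → X := fun k => Nat.rec x (fun _ w => w - A (φ w)) k
  have hy1 : ∀ k, y (k + 1) = y k - A (φ (y k)) := fun k => rfl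
  have hyr : ∀ k, y k ∈ LinearMap.range A := by
    intro k
    induction k with
    | zero => exact hx
    | succ k ih => rw [hy1]; exact sub_mem ih (LinearMap.mem_range_self A _)
  have hyn : ∀ k, ‖y k‖ ≤ ‖x‖ * ρ ^ k := by
    intro k
    induction k with
    | zero => simp [y]
    | succ k ih =>
      rw [hy1, pow_succ]
      calc _ ≤ ρ * ‖y k‖ := hφ2 _ (hyr k)
        _ ≤ ρ * (‖x‖ * ρ ^ k) := mul_le_mul_of_nonneg_left ih hρ0.le
        _ = _ := by ring
  have hφn : ∀ k, ‖φ (y k)‖ ≤ C * ‖x‖ * ρ ^ k := fun k => by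
    calc _ ≤ C * ‖y k‖ := hφ1 _ (hyr k)
      _ ≤ C * (‖x‖ * ρ ^ k) := mul_le_mul_of_nonneg_left (hyn k) hC
      _ = _ := by ring
  obtain ⟨z, hz1, hz2⟩ := exists_qTendsto_sum h1 hΔ (fun k => φ (y k))
    (mul_nonneg hC (IsQuasinormed.nonneg x)) hφn
  have hpartial : ∀ n, A (∑ k ∈ Finset.range n, φ (y k)) = x - y n := by
    intro n
    induction n with
    | zero => simp [y]
    | succ n ih => rw [Finset.sum_range_succ, map_add, ih, hy1]; abel
  refine ⟨z, (hz1.map A hA).unique ?_, ?_⟩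
  · simp only [hpartial]
    have h : Tendsto (fun k : ℕ => ‖x‖ * ρ ^ k) atTop (𝓝 0) := by
      simpa using (tendsto_pow_atTop_nhds_zero_of_lt_one hρ0.le
        (inv_lt_one_of_one_lt₀ (by linarith))).const_mul ‖x‖
    refine squeeze_zero (fun _ => IsQuasinormed.nonneg _) (fun n => ?_) h
    rw [sub_sub_cancel_left, norm_neg']
    exact hyn n
  · have h := hz2 0
    simp only [Finset.range_zero, Finset.sum_empty, sub_zero, pow_zero, mul_one] at h
    linarith

end OpenMapping

/-! ### Real-valued forms of the approximation constants. -/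

section Constants

variable {X : Type u} {Y : Type v} [AddCommGroup X] [Module ℝ X] [Norm X] [IsQuasinormed X]
  [AddCommGroup Y] [Module ℝ Y] [Norm Y] [IsQuasinormed Y]

/-- The additivity defect of `f` is controlled by `Q`. -/
def DefectLE (f : X → Y) (Q : ℝ) : Prop :=
  ∀ x y, ‖f (x + y) - f x - f y‖ ≤ Q * (‖x‖ + ‖y‖)

theorem IsHomogeneous.map_zero {f : X → Y} (hf : IsHomogeneous f) : f 0 = 0 := by
  simpa using hf 0 0

theorem isHomogeneous_linearMap (l : X →ₗ[ℝ] Y) : IsHomogeneous l := fun t x => map_smul l t x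

theorem IsHomogeneous.sub {f g : X → Y} (hf : IsHomogeneous f) (hg : IsHomogeneous g) :
    IsHomogeneous (fun x => f x - g x) := fun t x => by
  simp only [hf t x, hg t x, smul_sub]

theorem IsHomogeneous.const_smul {f : X → Y} (hf : IsHomogeneous f) (c : ℝ) :
    IsHomogeneous (fun x => c • f x) := fun t x => by
  simp only [hf t x, smul_comm c t]

theorem DefectLE.sub_linearMap {f : X → Y} {Q : ℝ} (hf : DefectLE f Q) (l : X →ₗ[ℝ] Y) :
    DefectLE (fun x => f x - l x) Q := fun x y => by
  have e : f (x + y) - l (x + y) - (f x - l x) - (f y - l y) = f (x + y) - f x - f y := by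
    rw [map_add]; abel
  simpa only [e] using hf x y

theorem DefectLE.const_smul {f : X → Y} {Q : ℝ} (hf : DefectLE f Q) (c : ℝ) :
    DefectLE (fun x => c • f x) (|c| * Q) := fun x y => by
  rw [← smul_sub, ← smul_sub, IsQuasinormed.smul, mul_assoc]
  exact mul_le_mul_of_nonneg_left (hf x y) (abs_nonneg c)

theorem DefectLE.mono {f : X → Y} {Q Q' : ℝ} (hf : DefectLE f Q) (h : Q ≤ Q') :
    DefectLE f Q' := fun x y =>
  (hf x y).trans (mul_le_mul_of_nonneg_right h
    (add_nonneg (IsQuasinormed.nonneg _) (IsQuasinormed.nonneg _)))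

/-- A homogeneous map without additivity defect, as a linear map. -/
def DefectLE.toLinearMap {f : X → Y} (hf : IsHomogeneous f) (h : DefectLE f 0) : X →ₗ[ℝ] Y where
  toFun := f
  map_add' x y := by
    have := eq_zero_of_norm_nonpos (by simpa using h x y)
    rw [sub_sub, sub_eq_zero] at this
    exact this
  map_smul' := hf

theorem homNorm_le_iff {g : X → Y} (hg : IsHomogeneous g) {C : ℝ} (hC : 0 ≤ C) :
    homNorm g ≤ ENNReal.ofReal C ↔ ∀ x, ‖g x‖ ≤ C * ‖x‖ := by
  unfold homNorm
  constructor
  · intro h x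
    by_cases hx : x = 0
    · simp [hx, hg.map_zero, norm_zero']
    · have h2 := (iSup₂_le_iff.1 h) (‖x‖⁻¹ • x) (norm_inv_smul hx)
      rw [ENNReal.ofReal_le_ofReal_iff hC, hg, IsQuasinormed.smul,
        abs_of_pos (inv_pos.2 (norm_pos hx)), inv_mul_le_iff₀ (norm_pos hx)] at h2
      linarith
  · intro h
    refine iSup₂_le fun x hx => ENNReal.ofReal_le_ofReal ?_
    simpa [hx] using h x

theorem isTrivialMap_iff {f : X → Y} (hf : IsHomogeneous f) :
    IsTrivialMap f ↔ ∃ (l : X →ₗ[ℝ] Y) (M : ℝ), 0 ≤ M ∧ ∀ x, ‖f x - l x‖ ≤ M * ‖x‖ := by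
  refine exists_congr fun l => ?_
  have hg := hf.sub (isHomogeneous_linearMap l)
  constructor
  · intro h
    exact ⟨_, ENNReal.toReal_nonneg, (homNorm_le_iff hg ENNReal.toReal_nonneg).1
      (ENNReal.ofReal_toReal h.ne).ge⟩
  · rintro ⟨M, hM, h⟩
    exact ((homNorm_le_iff hg hM).2 h).trans_lt ENNReal.ofReal_lt_top

theorem quasilinConst_le {f : X → Y} {Q : ℝ} (hQ : 0 ≤ Q) (hf : DefectLE f Q) :
    quasilinConst f ≤ ENNReal.ofReal Q := by
  refine sInf_le fun x y => ?_
  rw [← ENNReal.ofReal_mul hQ]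
  exact ENNReal.ofReal_le_ofReal (hf x y)

theorem IsQuasilinear.exists_defectLE {f : X → Y} (hf : IsQuasilinear f) :
    ∃ Q : ℝ, 0 ≤ Q ∧ DefectLE f Q := by
  obtain ⟨Q, hQ⟩ := hf.2
  exact ⟨max Q 0, le_max_right _ _, DefectLE.mono hQ (le_max_left _ _)⟩

theorem IsQuasilinear.quasilinConst_ne_top {f : X → Y} (hf : IsQuasilinear f) :
    quasilinConst f ≠ ⊤ := by
  obtain ⟨Q, hQ, h⟩ := hf.exists_defectLE
  exact ((quasilinConst_le hQ h).trans_lt ENNReal.ofReal_lt_top).ne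

/-- The infimum that defines `Q[f]` is attained. -/
theorem IsQuasilinear.defectLE_quasilinConst {f : X → Y} (hf : IsQuasilinear f) :
    DefectLE f (quasilinConst f).toReal := by
  intro x y
  have hb : 0 ≤ ‖x‖ + ‖y‖ := add_nonneg (IsQuasinormed.nonneg _) (IsQuasinormed.nonneg _)
  rcases hb.eq_or_lt with h0 | h0
  · obtain ⟨Q, hQ, h⟩ := hf.exists_defectLE
    simpa [← h0] using h x y
  · have h : ENNReal.ofReal ‖f (x + y) - f x - f y‖ / ENNReal.ofReal (‖x‖ + ‖y‖)
        ≤ quasilinConst f := by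
      refine le_sInf fun Q hQ => ?_
      rw [ENNReal.div_le_iff (by simpa using h0) ENNReal.ofReal_ne_top]
      exact hQ x y
    rw [ENNReal.div_le_iff (by simpa using h0) ENNReal.ofReal_ne_top,
      ← ENNReal.ofReal_toReal hf.quasilinConst_ne_top,
      ← ENNReal.ofReal_mul ENNReal.toReal_nonneg,
      ENNReal.ofReal_le_ofReal_iff (mul_nonneg ENNReal.toReal_nonneg hb)] at h
    exact h

variable (X Y) in
/-- Uniform linear approximation of the normalized quasilinear maps with the property `P`. -/
def UniformlyApproximable (P : (X → Y) → Prop) : Prop :=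
  ∃ C : ℝ, 0 ≤ C ∧ ∀ f : X → Y, IsHomogeneous f → DefectLE f 1 → P f →
    ∃ l : X →ₗ[ℝ] Y, ∀ x, ‖f x - l x‖ ≤ C * ‖x‖

/-- Dividing by `Q[f]` normalizes the defect to one, and `hP` keeps the rescaled map in the class.
It serves both `approxK` and `approxK₀`. -/
theorem uniformlyApproximable_iff (P : (X → Y) → Prop)
    (hP : ∀ (c : ℝ) (f : X → Y), P f → P (fun x => c • f x)) :
    sInf {C : ℝ≥0∞ | ∀ f : X → Y, IsQuasilinear f → P f →
      ∃ l : X →ₗ[ℝ] Y, homNorm (fun x => f x - l x) ≤ C * quasilinConst f} < ⊤ ↔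
    UniformlyApproximable X Y P := by
  rw [sInf_lt_iff]
  constructor
  · rintro ⟨C, hC, hC'⟩
    refine ⟨C.toReal, ENNReal.toReal_nonneg, fun f hf hQ hPf => ?_⟩
    obtain ⟨l, hl⟩ := hC f ⟨hf, 1, hQ⟩ hPf
    refine ⟨l, (homNorm_le_iff (hf.sub (isHomogeneous_linearMap l)) ENNReal.toReal_nonneg).1 ?_⟩
    rw [ENNReal.ofReal_toReal hC'.ne]
    refine hl.trans ?_
    calc C * quasilinConst f ≤ C * ENNReal.ofReal 1 := by
          gcongr; exact quasilinConst_le zero_le_one hQ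
      _ = C := by simp
  · rintro ⟨C, hC, h⟩
    refine ⟨ENNReal.ofReal C, fun f hf hPf => ?_, ENNReal.ofReal_lt_top⟩
    have hd := hf.defectLE_quasilinConst
    rw [← ENNReal.ofReal_toReal hf.quasilinConst_ne_top, ← ENNReal.ofReal_mul hC]
    set q := (quasilinConst f).toReal with hq
    have hq0 : 0 ≤ q := ENNReal.toReal_nonneg
    -- If `Q[f] = 0` no rescaling is possible, but then `f` is itself linear.
    rcases hq0.eq_or_lt with h0 | h0
    · rw [← h0] at hd
      refine ⟨hd.toLinearMap hf.1,
        (homNorm_le_iff (hf.1.sub (isHomogeneous_linearMap _)) (by positivity)).2 fun x => ?_⟩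
      have : f x - hd.toLinearMap hf.1 x = 0 := sub_self (f x)
      rw [this, norm_zero']
      exact mul_nonneg (by positivity) (IsQuasinormed.nonneg x)
    · obtain ⟨l, hl⟩ := h (fun x => q⁻¹ • f x) (hf.1.const_smul _) (by
        have := hd.const_smul q⁻¹
        rwa [abs_of_pos (inv_pos.2 h0), inv_mul_cancel₀ h0.ne'] at this) (hP _ _ hPf)
      refine ⟨q • l,
        (homNorm_le_iff (hf.1.sub (isHomogeneous_linearMap _)) (by positivity)).2 fun x => ?_⟩
      have e : f x - (q • l) x = q • (q⁻¹ • f x - l x) := by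
        rw [smul_sub, smul_inv_smul₀ h0.ne', LinearMap.smul_apply]
      rw [e, IsQuasinormed.smul, abs_of_pos h0]
      calc q * ‖q⁻¹ • f x - l x‖ ≤ q * (C * ‖x‖) := mul_le_mul_of_nonneg_left (hl x) hq0
        _ = _ := by ring

theorem IsBoundedMap.const_smul {f : X → Y} (hf : IsBoundedMap f) (c : ℝ) :
    IsBoundedMap (fun x => c • f x) := by
  obtain ⟨M, hM⟩ := hf
  refine ⟨|c| * M, fun x => ?_⟩
  rw [IsQuasinormed.smul, mul_assoc]
  exact mul_le_mul_of_nonneg_left (hM x) (abs_nonneg c)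

theorem IsBoundedMap.exists_nonneg {f : X → Y} (hf : IsBoundedMap f) :
    ∃ M : ℝ, 0 ≤ M ∧ ∀ x, ‖f x‖ ≤ M * ‖x‖ := by
  obtain ⟨M, hM⟩ := hf
  exact ⟨max M 0, le_max_right _ _, fun x => (hM x).trans
    (mul_le_mul_of_nonneg_right (le_max_left _ _) (IsQuasinormed.nonneg x))⟩

theorem approxK_lt_top_iff :
    approxK X Y < ⊤ ↔ UniformlyApproximable X Y (fun _ => True) := by
  rw [← uniformlyApproximable_iff (fun _ => True) (fun _ _ h => h)]
  simp [approxK]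

theorem approxK₀_lt_top_iff :
    approxK₀ X Y < ⊤ ↔ UniformlyApproximable X Y IsBoundedMap :=
  uniformlyApproximable_iff IsBoundedMap fun c _ h => h.const_smul c

/-- Uniform approximation rescaled to an arbitrary positive defect. -/
theorem UniformlyApproximable.approx {C Q : ℝ} {f : X → Y}
    (hC : ∀ f : X → Y, IsHomogeneous f → DefectLE f 1 → IsBoundedMap f →
      ∃ l : X →ₗ[ℝ] Y, ∀ x, ‖f x - l x‖ ≤ C * ‖x‖)
    (hf : IsHomogeneous f) (hb : IsBoundedMap f) (hQ : 0 < Q) (hd : DefectLE f Q) :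
    ∃ l : X →ₗ[ℝ] Y, ∀ x, ‖f x - l x‖ ≤ C * Q * ‖x‖ := by
  obtain ⟨l, hl⟩ := hC (fun x => Q⁻¹ • f x) (hf.const_smul _) (by
    have := hd.const_smul Q⁻¹
    rwa [abs_of_pos (inv_pos.2 hQ), inv_mul_cancel₀ hQ.ne'] at this) (hb.const_smul _)
  refine ⟨Q • l, fun x => ?_⟩
  have e : f x - (Q • l) x = Q • (Q⁻¹ • f x - l x) := by
    rw [smul_sub, smul_inv_smul₀ hQ.ne', LinearMap.smul_apply]
  rw [e, IsQuasinormed.smul, abs_of_pos hQ]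
  calc Q * ‖Q⁻¹ • f x - l x‖ ≤ Q * (C * ‖x‖) := mul_le_mul_of_nonneg_left (hl x) hQ.le
    _ = _ := by ring

theorem isTrivialMap_of_approxK_lt_top (h : approxK X Y < ⊤) (f : X → Y)
    (hf : IsQuasilinear f) : IsTrivialMap f := by
  obtain ⟨C, hC, hC'⟩ := sInf_lt_iff.1 h
  obtain ⟨l, hl⟩ := hC f hf
  exact ⟨l, hl.trans_lt (ENNReal.mul_lt_top hC' hf.quasilinConst_ne_top.lt_top)⟩

theorem approxK₀_le_approxK : approxK₀ X Y ≤ approxK X Y :=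
  sInf_le_sInf fun _ hC f hf _ => hC f hf

end Constants

/-! ### Twisted sums: from quasilinear maps to extensions. -/

section TwistedSums

variable {X : Type u} {Y : Type v} [AddCommGroup X] [Module ℝ X] [Norm X]
  [AddCommGroup Y] [Module ℝ Y] [Norm Y]

/-- The twisted sum of `Y` and `X` along `f : X → Y`, quasinormed by `‖y - f x‖ + ‖x‖`. -/
def TwistedSum (_ : X → Y) : Type (max u v) := Y × X

namespace TwistedSum

variable (f : X → Y)

instance : AddCommGroup (TwistedSum f) := inferInstanceAs (AddCommGroup (Y × X))
instance : Module ℝ (TwistedSum f) := inferInstanceAs (Module ℝ (Y × X))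
instance : Norm (TwistedSum f) := ⟨fun z => ‖z.1 - f z.2‖ + ‖z.2‖⟩

/-- The inclusion of `Y`. -/
def inl : Y →ₗ[ℝ] TwistedSum f := LinearMap.inl ℝ Y X

/-- The linear, in general unbounded, section. -/
def inr : X →ₗ[ℝ] TwistedSum f := LinearMap.inr ℝ Y X

/-- The quotient map onto `X`. -/
def snd : TwistedSum f →ₗ[ℝ] X := LinearMap.snd ℝ Y X

/-- The first coordinate. -/
def fst : TwistedSum f →ₗ[ℝ] Y := LinearMap.fst ℝ Y X

variable {f}

theorem norm_def (z : TwistedSum f) : ‖z‖ = ‖fst f z - f (snd f z)‖ + ‖snd f z‖ := rfl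

@[simp] theorem fst_inl (y : Y) : fst f (inl f y) = y := rfl
@[simp] theorem snd_inl (y : Y) : snd f (inl f y) = 0 := rfl
@[simp] theorem fst_inr (x : X) : fst f (inr f x) = 0 := rfl
@[simp] theorem snd_inr (x : X) : snd f (inr f x) = x := rfl

theorem ext' {z z' : TwistedSum f} (h1 : fst f z = fst f z') (h2 : snd f z = snd f z') : z = z' :=
  Prod.ext h1 h2

variable [IsQuasinormed X] [IsQuasinormed Y]

theorem isQuasinormed (hf : IsQuasilinear f) : IsQuasinormed (TwistedSum f) where
  nonneg z := add_nonneg (IsQuasinormed.nonneg _) (IsQuasinormed.nonneg _)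
  eq_zero_iff z := by
    rw [norm_def]
    constructor
    · intro h
      have h1 := IsQuasinormed.nonneg (fst f z - f (snd f z))
      have h2 := IsQuasinormed.nonneg (snd f z)
      have h3 : snd f z = 0 := eq_zero_of_norm_nonpos (by linarith)
      have h4 := eq_zero_of_norm_nonpos (by linarith : ‖fst f z - f (snd f z)‖ ≤ 0)
      rw [h3, hf.1.map_zero, sub_zero] at h4
      exact ext' h4 h3
    · rintro rfl
      simp [hf.1.map_zero, norm_zero']
  smul t z := by
    rw [norm_def, norm_def, map_smul, map_smul, hf.1, ← smul_sub, IsQuasinormed.smul,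
      IsQuasinormed.smul, mul_add]
  add_le := by
    obtain ⟨Δ, h1, hΔ⟩ := exists_modulus X
    obtain ⟨Γ, hΓ1, hΓ⟩ := exists_modulus Y
    obtain ⟨Q, hQ, hd⟩ := hf.exists_defectLE
    refine ⟨Γ * Γ + Γ * Q + Δ, fun z z' => ?_⟩
    simp only [norm_def, map_add]
    set y := fst f z; set y' := fst f z'; set x := snd f z; set x' := snd f z'
    have e : y + y' - f (x + x') = ((y - f x) + (y' - f x')) - (f (x + x') - f x - f x') := by
      abel
    have g1 := sub_le_of_modulus hΓ ((y - f x) + (y' - f x')) (f (x + x') - f x - f x')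
    have g2 := mul_le_mul_of_nonneg_left (add_le_add (hΓ (y - f x) (y' - f x')) (hd x x'))
      (by linarith : 0 ≤ Γ)
    have g3 := hΔ x x'
    rw [← e] at g1
    have p1 := IsQuasinormed.nonneg (y - f x)
    have p2 := IsQuasinormed.nonneg (y' - f x')
    have p3 := IsQuasinormed.nonneg x
    have p4 := IsQuasinormed.nonneg x'
    have q1 : 0 ≤ Γ * Q := by positivity
    have q2 : 0 ≤ Γ * Γ := by positivity
    have r1 := mul_nonneg (add_nonneg q1 (by linarith : 0 ≤ Δ)) (add_nonneg p1 p2)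
    have r2 := mul_nonneg q2 (add_nonneg p3 p4)
    nlinarith

theorem norm_inl (hf : IsQuasilinear f) (y : Y) : ‖inl f y‖ = ‖y‖ := by
  simp [norm_def, hf.1.map_zero, norm_zero']

/-- A lifting of vectors of `X` that preserves the quasinorm. -/
theorem norm_lift (x : X) : ‖inl f (f x) + inr f x‖ = ‖x‖ := by
  simp [norm_def, norm_zero']

end TwistedSum

/-- The second coordinates of a Cauchy sequence converge to some `x`. Subtracting norm-preserving
lifts of their differences with `x`, which tend to zero, leaves a Cauchy sequence in a translate of
the copy of `Y`, where completeness of `Y` applies. -/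
theorem TwistedSum.isQuasiBanach [IsQuasiBanach X] [IsQuasiBanach Y] {f : X → Y}
    (hf : IsQuasilinear f) : IsQuasiBanach (TwistedSum f) := by
  have := TwistedSum.isQuasinormed hf
  refine ⟨fun z hz => ?_⟩
  obtain ⟨Δ, h1, hΔ⟩ := exists_modulus (TwistedSum f)
  have hsnd : ∀ w : TwistedSum f, ‖snd f w‖ ≤ ‖w‖ := fun w =>
    le_add_of_nonneg_left (IsQuasinormed.nonneg _)
  obtain ⟨x, hx⟩ := IsQuasiBanach.complete (fun n => snd f (z n)) (by
    intro ε hε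
    obtain ⟨N, hN⟩ := hz ε hε
    refine ⟨N, fun m n hm hn => lt_of_le_of_lt ?_ (hN m n hm hn)⟩
    rw [← map_sub]
    exact hsnd _)
  let w : ℕ → TwistedSum f := fun n =>
    inl f (f (snd f (z n) - x)) + inr f (snd f (z n) - x)
  have hw : Tendsto (fun n => ‖w n‖) atTop (𝓝 0) := by
    simpa only [w, norm_lift] using hx
  let v : ℕ → Y := fun n => fst f (z n) - f (snd f (z n) - x)
  have hv : ∀ n, z n = w n + (inl f (v n) + inr f x) := by
    intro n
    refine ext' ?_ ?_ <;> simp [w, v]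
  obtain ⟨y, hy⟩ := IsQuasiBanach.complete v (by
    intro ε hε
    have hε' : 0 < ε / (Δ * (1 + 2 * Δ)) := by positivity
    obtain ⟨N, hN⟩ := hz _ hε'
    obtain ⟨N', hN'⟩ := (hw.eventually_lt_const hε').exists_forall_of_atTop
    refine ⟨max N N', fun m n hm hn => ?_⟩
    have e : inl f (v m - v n) = (z m - z n) - (w m - w n) := by
      rw [hv m, hv n, map_sub]; abel
    rw [← norm_inl hf, e]
    have g1 := sub_le_of_modulus hΔ (z m - z n) (w m - w n)
    have g2 := sub_le_of_modulus hΔ (w m) (w n)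
    have g3 := hN m n (by omega) (by omega)
    have g4 := hN' m (by omega)
    have g5 := hN' n (by omega)
    calc _ ≤ _ := g1
      _ ≤ Δ * (‖z m - z n‖ + Δ * (‖w m‖ + ‖w n‖)) := by gcongr
      _ < Δ * (ε / (Δ * (1 + 2 * Δ)) + Δ * (ε / (Δ * (1 + 2 * Δ)) + ε / (Δ * (1 + 2 * Δ)))) := by
        gcongr
      _ = ε := by field_simp; ring)
  refine ⟨inl f y + inr f x, ?_⟩
  have h : Tendsto (fun n => Δ * (‖w n‖ + ‖v n - y‖)) atTop (𝓝 0) := by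
    simpa using (hw.add hy).const_mul Δ
  refine squeeze_zero (fun n => IsQuasinormed.nonneg _) (fun n => ?_) h
  have e : z n - (inl f y + inr f x) = w n + inl f (v n - y) := by
    rw [hv n, map_sub (inl f) (v n) y]; abel
  rw [e, ← norm_inl hf]
  exact hΔ _ _

-- A bounded retraction `r` evaluated on the norm-preserving lift of `x` equals `f x + r (inr f x)`,
-- so `x ↦ -r (inr f x)` is a linear map at finite distance from `f`.
open TwistedSum in
theorem isTrivialMap_of_everyExtensionSplits [IsQuasiBanach X] [IsQuasiBanach Y]
    (h : EveryExtensionSplits X Y) (f : X → Y) (hf : IsQuasilinear f) : IsTrivialMap f := by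
  have := TwistedSum.isQuasiBanach hf
  obtain ⟨r, ⟨M, hM⟩, hr⟩ := h (TwistedSum f) (inl f) (snd f)
    ⟨1, fun y => by rw [norm_inl hf, one_mul]⟩
    ⟨1, fun z => by rw [one_mul]; exact le_add_of_nonneg_left (IsQuasinormed.nonneg _)⟩
    (fun y y' hyy' => by simpa using congrArg (fst f) hyy')
    (by
      ext z
      rw [LinearMap.mem_range, LinearMap.mem_ker]
      constructor
      · rintro ⟨y, rfl⟩; simp
      · intro hz
        exact ⟨fst f z, ext' (by simp) (by simp [hz])⟩)
    (fun x => ⟨inr f x, snd_inr x⟩)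
  rw [isTrivialMap_iff hf.1]
  refine ⟨-(r ∘ₗ inr f), max M 0, le_max_right _ _, fun x => ?_⟩
  have e : f x - (-(r ∘ₗ inr f)) x = r (inl f (f x) + inr f x) := by
    have := LinearMap.congr_fun hr (f x)
    simp only [LinearMap.comp_apply, LinearMap.id_apply] at this
    rw [map_add, this]; simp
  rw [e]
  refine (hM _).trans ?_
  rw [norm_lift]
  exact mul_le_mul_of_nonneg_right (le_max_left _ _) (IsQuasinormed.nonneg x)

end TwistedSums

/-! ### Making selections homogeneous. -/

section Homogenization

variable {X : Type u} {Y : Type v} [AddCommGroup X] [Module ℝ X] [Norm X] [IsQuasinormed X]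
  [AddCommGroup Y] [Module ℝ Y] [Norm Y] [IsQuasinormed Y]

variable (X) in
/-- A choice of a normalized vector `e x` on the line of `x`, with the coordinate `τ x` of `x`. -/
theorem exists_polar_decomposition : ∃ (e : X → X) (τ : X → ℝ), (∀ x, τ x • e x = x) ∧
    (∀ x, |τ x| = ‖x‖) ∧ (∀ x, ‖e x‖ ≤ 1) ∧ (∀ (t : ℝ) x, τ (t • x) = t * τ x) ∧
    ∀ (t : ℝ) x, t ≠ 0 → e (t • x) = e x := by
  classical
  -- The projective point supplies a representative that depends only on the line of `x`.
  let e : X → X := fun x => if h : x = 0 then 0 else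
    ‖(Projectivization.mk ℝ x h).rep‖⁻¹ • (Projectivization.mk ℝ x h).rep
  have he : ∀ x, x ≠ 0 → ‖e x‖ = 1 := by
    intro x hx
    simp only [e, dif_neg hx]
    exact norm_inv_smul (Projectivization.rep_nonzero _)
  have hτ : ∀ x, ∃ t : ℝ, t • e x = x := by
    intro x
    by_cases hx : x = 0
    · exact ⟨0, by simp [hx]⟩
    · obtain ⟨a, ha⟩ := Projectivization.exists_smul_eq_mk_rep ℝ x hx
      have hn := norm_pos (Projectivization.rep_nonzero (Projectivization.mk ℝ x hx))
      refine ⟨(a⁻¹ : ℝˣ) * ‖(Projectivization.mk ℝ x hx).rep‖, ?_⟩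
      simp only [e, dif_neg hx]
      rw [smul_smul, mul_assoc, mul_inv_cancel₀ hn.ne', mul_one, ← ha]
      exact inv_smul_smul a x
  choose τ hτ using hτ
  have hes : ∀ (t : ℝ) x, t ≠ 0 → e (t • x) = e x := by
    intro t x ht
    by_cases hx : x = 0
    · simp [hx]
    · have htx : t • x ≠ 0 := smul_ne_zero ht hx
      have : Projectivization.mk ℝ (t • x) htx = Projectivization.mk ℝ x hx := by
        rw [Projectivization.mk_eq_mk_iff']
        exact ⟨t, rfl⟩
      simp only [e, dif_neg hx, dif_neg htx, this]
  have hτ0 : ∀ x, x ≠ 0 → ∀ t : ℝ, t • e x = x → t = τ x := by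
    intro x hx t ht
    have hne : e x ≠ 0 := by
      intro h
      have := he x hx
      rw [h, norm_zero'] at this
      exact zero_ne_one this
    exact smul_left_injective ℝ hne (ht.trans (hτ x).symm)
  -- At zero the chosen coordinate is arbitrary, because `e 0 = 0`, and must be reset.
  refine ⟨e, fun x => if x = 0 then 0 else τ x, fun x => ?_, fun x => ?_, fun x => ?_,
    fun t x => ?_, hes⟩
  · by_cases hx : x = 0
    · simp [hx]
    · simpa [hx] using hτ x
  · by_cases hx : x = 0
    · simp [hx, norm_zero']
    · have h := IsQuasinormed.smul (τ x) (e x)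
      rw [hτ, he x hx, mul_one] at h
      simp [hx, h]
  · by_cases hx : x = 0
    · simp [e, hx, norm_zero']
    · exact (he x hx).le
  · by_cases hx : x = 0
    · simp [hx]
    by_cases ht : t = 0
    · simp [ht]
    have htx : t • x ≠ 0 := smul_ne_zero ht hx
    simp only [hx, htx, if_false]
    refine (hτ0 _ htx _ ?_).symm
    rw [hes t x ht, mul_smul, hτ x]

theorem isHomogeneous_of_polar {e : X → X} {τ : X → ℝ}
    (hτ : ∀ (t : ℝ) x, τ (t • x) = t * τ x) (he : ∀ (t : ℝ) x, t ≠ 0 → e (t • x) = e x)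
    (φ : X → Y) : IsHomogeneous (fun x => τ x • φ (e x)) := by
  intro t x
  simp only [hτ, mul_smul]
  by_cases ht : t = 0
  · simp [ht]
  · rw [he t x ht]

/-- Bounded liftings can be made homogeneous. -/
theorem exists_homogeneous_section (q : Y →ₗ[ℝ] X) {C : ℝ} (hC0 : 0 ≤ C)
    (hC : ∀ x, ∃ z, q z = x ∧ ‖z‖ ≤ C * ‖x‖) :
    ∃ B : X → Y, IsHomogeneous B ∧ (∀ x, q (B x) = x) ∧ ∀ x, ‖B x‖ ≤ C * ‖x‖ := by
  choose φ hφ1 hφ2 using hC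
  obtain ⟨e, τ, h1, h2, h3, h4, h5⟩ := exists_polar_decomposition X
  refine ⟨fun x => τ x • φ (e x), isHomogeneous_of_polar h4 h5 φ, fun x => ?_, fun x => ?_⟩
  · rw [map_smul, hφ1, h1]
  · rw [IsQuasinormed.smul, h2]
    calc ‖x‖ * ‖φ (e x)‖ ≤ ‖x‖ * (C * 1) :=
          mul_le_mul_of_nonneg_left ((hφ2 _).trans (mul_le_mul_of_nonneg_left (h3 x) hC0))
            (IsQuasinormed.nonneg x)
      _ = C * ‖x‖ := by ring

end Homogenization

/-! ### From extensions to quasilinear maps. -/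

section Extensions

variable {X : Type u} {Y : Type v} [AddCommGroup X] [Module ℝ X] [Norm X] [IsQuasiBanach X]
  [AddCommGroup Y] [Module ℝ Y] [Norm Y] [IsQuasiBanach Y]

/-- The extension is measured by `f = s ∘ B`, with `B` a bounded homogeneous section of `q` and `s`
an algebraic left inverse of `j`. If `l` is a linear map close to `f`, then `s - l ∘ q` is still a
left inverse of `j`, and it is bounded. -/
theorem everyExtensionSplits_of_isTrivialMap
    (h : ∀ f : X → Y, IsQuasilinear f → IsTrivialMap f) : EveryExtensionSplits X Y := by
  intro Z _ _ _ _ j q hj hq hji hjq hqs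
  obtain ⟨C₁, hC₁, hq'⟩ := exists_bounded_preimage q hq (by
    intro s x _ _
    rw [LinearMap.range_eq_top.2 hqs]
    trivial)
  obtain ⟨C₂, hC₂, hj'⟩ := exists_bounded_preimage j hj (by
    intro s z hs hz
    rw [hjq] at hs ⊢
    have h1 := hz.map q hq
    have h2 : ∀ n, q (s n) = 0 := fun n => LinearMap.mem_ker.1 (hs n)
    simp only [h2] at h1
    exact LinearMap.mem_ker.2 (h1.unique (QTendsto.const 0)))
  have hjn : ∀ y, ‖y‖ ≤ C₂ * ‖j y‖ := by
    intro y
    obtain ⟨y', h1, h2⟩ := hj' (j y) (LinearMap.mem_range_self j y)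
    rwa [hji h1] at h2
  obtain ⟨B, hB1, hB2, hB3⟩ := exists_homogeneous_section q hC₁
    (fun x => hq' x (by rw [LinearMap.range_eq_top.2 hqs]; trivial))
  obtain ⟨s, hs⟩ := j.exists_leftInverse_of_injective (LinearMap.ker_eq_bot.2 hji)
  have hs' : ∀ y, s (j y) = y := fun y => LinearMap.congr_fun hs y
  have hjs : ∀ z, q z = 0 → j (s z) = z := by
    intro z hz
    have : z ∈ LinearMap.range j := by rw [hjq]; exact LinearMap.mem_ker.2 hz
    obtain ⟨y, rfl⟩ := this
    rw [hs']
  have hsn : ∀ z, q z = 0 → ‖s z‖ ≤ C₂ * ‖z‖ := fun z hz => by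
    simpa only [hjs z hz] using hjn (s z)
  obtain ⟨Δ, h1, hΔ⟩ := exists_modulus Z
  obtain ⟨Δ', h1', hΔ'⟩ := exists_modulus X
  -- The additivity defect of `B` lies in the kernel of `q`, and there `s` is bounded although it
  -- need not be so on `Z`.
  let f : X → Y := fun x => s (B x)
  have hf : IsQuasilinear f := by
    refine ⟨fun t x => ?_, C₂ * (Δ * (Δ * (C₁ * Δ' + C₁) + C₁)), fun x y => ?_⟩
    · simp only [f]; rw [hB1, map_smul]
    · have e : f (x + y) - f x - f y = s (B (x + y) - B x - B y) := by
        simp only [f, map_sub]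
      rw [e]
      refine (hsn _ (by simp [hB2])).trans ?_
      rw [mul_assoc]
      refine mul_le_mul_of_nonneg_left ?_ hC₂
      have p1 := IsQuasinormed.nonneg x
      have p2 := IsQuasinormed.nonneg y
      calc ‖B (x + y) - B x - B y‖ ≤ Δ * (Δ * (‖B (x + y)‖ + ‖B x‖) + ‖B y‖) :=
            (sub_le_of_modulus hΔ _ _).trans (mul_le_mul_of_nonneg_left
              (add_le_add (sub_le_of_modulus hΔ _ _) le_rfl) (by linarith))
        _ ≤ Δ * (Δ * (C₁ * (Δ' * (‖x‖ + ‖y‖)) + C₁ * (‖x‖ + ‖y‖)) + C₁ * (‖x‖ + ‖y‖)) := by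
            gcongr
            · exact (hB3 _).trans (mul_le_mul_of_nonneg_left (hΔ' x y) hC₁)
            · exact (hB3 _).trans (mul_le_mul_of_nonneg_left (by linarith) hC₁)
            · exact (hB3 _).trans (mul_le_mul_of_nonneg_left (by linarith) hC₁)
        _ = _ := by ring
  obtain ⟨l, M, hM, hl⟩ := (isTrivialMap_iff hf.1).1 (h f hf)
  obtain ⟨Γ, hΓ1, hΓ⟩ := exists_modulus Y
  obtain ⟨Mq, hMq, hqn⟩ := IsBoundedMap.exists_nonneg hq
  refine ⟨s - l ∘ₗ q,
    ⟨Γ * (C₂ * (Δ * (1 + C₁ * Mq)) + M * Mq), fun z => ?_⟩, ?_⟩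
  · have e : (s - l ∘ₗ q) z
        = s (z - B (q z)) + (f (q z) - l (q z)) := by
      simp only [f, LinearMap.sub_apply, LinearMap.comp_apply, map_sub]
      abel
    rw [e]
    have g1 : ‖z - B (q z)‖ ≤ Δ * ((1 + C₁ * Mq) * ‖z‖) := by
      refine (sub_le_of_modulus hΔ _ _).trans (mul_le_mul_of_nonneg_left ?_ (by linarith))
      have := (hB3 (q z)).trans (mul_le_mul_of_nonneg_left (hqn z) hC₁)
      linarith
    calc _ ≤ Γ * (‖s (z - B (q z))‖ + ‖f (q z) - l (q z)‖) := hΓ _ _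
      _ ≤ Γ * (C₂ * (Δ * ((1 + C₁ * Mq) * ‖z‖)) + M * (Mq * ‖z‖)) := by
        gcongr
        · exact (hsn _ (by simp [hB2])).trans (mul_le_mul_of_nonneg_left g1 hC₂)
        · exact (hl _).trans (mul_le_mul_of_nonneg_left (hqn z) hM)
      _ = _ := by ring
  · ext y
    have : q (j y) = 0 := by
      have hy := LinearMap.mem_range_self j y
      rw [hjq] at hy
      exact LinearMap.mem_ker.1 hy
    simp [this, hs']

end Extensions

/-! ### The quasinorm of an ultrapower. -/

section UltrapowerNorm

variable {I : Type w} {U : Ultrafilter I} {X : Type u} [AddCommGroup X] [Module ℝ X] [Norm X]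
  [IsQuasinormed X]

namespace Ultrapower

theorem mk_surjective (z : Ultrapower U X) : ∃ x, mk U X x = z :=
  Submodule.mkQ_surjective _ z

theorem mk_eq_mk_iff {x y : finiteFamilies U X} :
    mk U X x = mk U X y ↔ Tendsto (fun i => ‖x.1 i - y.1 i‖) (U : Filter I) (𝓝 0) :=
  Submodule.Quotient.eq _

theorem norm_nonneg' (z : Ultrapower U X) : 0 ≤ ‖z‖ := by
  refine Real.sInf_nonneg ?_
  rintro r ⟨x, -, hx⟩
  exact ge_of_tendsto hx (Eventually.of_forall fun i => IsQuasinormed.nonneg _)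

theorem exists_tendsto_norm (x : finiteFamilies U X) :
    ∃ r : ℝ, Tendsto (fun i => ‖x.1 i‖) (U : Filter I) (𝓝 r) := by
  obtain ⟨M, hM⟩ := x.2
  have h : Set.Icc 0 M ∈ U.map (fun i => ‖x.1 i‖) := by
    rw [Ultrafilter.mem_map]
    exact hM.mono fun i hi => ⟨IsQuasinormed.nonneg _, hi⟩
  obtain ⟨r, -, hr⟩ := isCompact_Icc.ultrafilter_le_nhds' _ h
  exact ⟨r, hr⟩

theorem norm_mk_le {x : finiteFamilies U X} {M : ℝ} (hM : ∀ᶠ i in (U : Filter I), ‖x.1 i‖ ≤ M) :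
    ‖mk U X x‖ ≤ M := by
  obtain ⟨r, hr⟩ := exists_tendsto_norm x
  refine le_trans (csInf_le ⟨0, ?_⟩ ⟨x, rfl, hr⟩) (le_of_tendsto hr hM)
  rintro r ⟨y, -, hy⟩
  exact ge_of_tendsto hy (Eventually.of_forall fun i => IsQuasinormed.nonneg _)

theorem exists_rep_of_norm_lt {z : Ultrapower U X} {r : ℝ} (hr : ‖z‖ < r) :
    ∃ x, mk U X x = z ∧ ∀ᶠ i in (U : Filter I), ‖x.1 i‖ < r := by
  obtain ⟨x₀, hx₀⟩ := mk_surjective z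
  obtain ⟨r₀, hr₀⟩ := exists_tendsto_norm x₀
  obtain ⟨s, ⟨x, hx, hxs⟩, hsr⟩ := exists_lt_of_csInf_lt
    (s := {r : ℝ | ∃ x : finiteFamilies U X,
      mk U X x = z ∧ Tendsto (fun i => ‖x.1 i‖) (U : Filter I) (𝓝 r)})
    ⟨r₀, x₀, hx₀, hr₀⟩ hr
  exact ⟨x, hx, hxs.eventually_lt_const hsr⟩

/-- Since the quasinorm may be discontinuous, an arbitrary representative is controlled only up to
the modulus. The `1` absorbs its infinitesimal distance to a good representative. -/
theorem eventually_le_of_norm_mk_lt {Δ : ℝ} (h1 : 1 ≤ Δ)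
    (hΔ : ∀ x y : X, ‖x + y‖ ≤ Δ * (‖x‖ + ‖y‖)) {x : finiteFamilies U X} {r : ℝ}
    (hr : ‖mk U X x‖ < r) : ∀ᶠ i in (U : Filter I), ‖x.1 i‖ ≤ Δ * (r + 1) := by
  obtain ⟨y, hy, hyr⟩ := exists_rep_of_norm_lt hr
  filter_upwards [hyr, (mk_eq_mk_iff.1 hy).eventually_lt_const one_pos] with i h2 h3
  calc ‖x.1 i‖ = ‖y.1 i - (y.1 i - x.1 i)‖ := by simp
    _ ≤ Δ * (‖y.1 i‖ + ‖y.1 i - x.1 i‖) := sub_le_of_modulus hΔ _ _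
    _ ≤ _ := mul_le_mul_of_nonneg_left (by linarith) (by linarith)

end Ultrapower

end UltrapowerNorm

/-! ### Gluing linear approximations in an ultrasummand. -/

section Ultrasummand

variable {X Y : Type u} [AddCommGroup X] [Module ℝ X] [Norm X] [IsQuasinormed X]
  [AddCommGroup Y] [Module ℝ Y] [Norm Y] [IsQuasinormed Y]

variable (X) in
/-- Linear approximation with values in an ultrasummand is of finite character, up to a
constant. -/
theorem IsUltrasummand.exists_linear_approx (hY : IsUltrasummand Y) :
    ∃ C : ℝ, 0 ≤ C ∧ ∀ (f : X → Y) (c : ℝ),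
      (∀ s : Finset X, ∃ m : X →ₗ[ℝ] Y, ∀ x ∈ s, ‖f x - m x‖ ≤ c * ‖x‖) →
      ∃ l : X →ₗ[ℝ] Y, ∀ x, ‖f x - l x‖ ≤ C * (c * ‖x‖) := by
  classical
  -- The summand `ℕ` guarantees countable incompleteness whatever `X` is: no finite set contains all
  -- the integers.
  let J := Finset (X ⊕ ULift.{u} ℕ)
  let V : Ultrafilter J := Ultrafilter.of atTop
  have hmem : ∀ a : X ⊕ ULift.{u} ℕ, ∀ᶠ j in (V : Filter J), a ∈ j := by
    intro a
    refine Ultrafilter.of_le atTop ?_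
    filter_upwards [eventually_ge_atTop ({a} : Finset (X ⊕ ULift.{u} ℕ))] with j hj
    exact hj (Finset.mem_singleton_self a)
  obtain ⟨P, ⟨M, hM⟩, hP⟩ := hY J V ⟨fun n => {j : J | (Sum.inr ⟨n⟩ : X ⊕ ULift.{u} ℕ) ∈ j}, fun n => hmem (Sum.inr ⟨n⟩), by
    refine Set.eq_empty_of_forall_notMem fun j hj => ?_
    refine Set.infinite_of_injective_forall_mem (f := fun n : ℕ => (Sum.inr ⟨n⟩ : X ⊕ ULift ℕ))
      ?_ (Set.mem_iInter.1 hj) j.finite_toSet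
    intro a b hab
    simpa using hab⟩
  refine ⟨max M 0, le_max_right _ _, fun f c h => ?_⟩
  choose m hm using h
  let μ : J → X →ₗ[ℝ] Y := fun j => m j.toLeft
  have hμ : ∀ x, ∀ᶠ j in (V : Filter J), ‖f x - μ j x‖ ≤ c * ‖x‖ := by
    intro x
    filter_upwards [hmem (Sum.inl x)] with j hj
    exact hm _ _ (Finset.mem_toLeft.2 hj)
  have hfin : ∀ x, (fun j => μ j x) ∈ finiteFamilies V Y := by
    intro x
    have h1 : (fun _ => f x) ∈ finiteFamilies V Y := ⟨‖f x‖, Eventually.of_forall fun _ => le_rfl⟩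
    have h2 : (fun j => f x - μ j x) ∈ finiteFamilies V Y := ⟨_, hμ x⟩
    have h3 := sub_mem h1 h2
    have e : (fun j => μ j x) = (fun _ => f x) - fun j => f x - μ j x := by
      funext j; simp
    rw [e]; exact h3
  let Λ : X →ₗ[ℝ] finiteFamilies V Y :=
    { toFun := fun x => ⟨fun j => μ j x, hfin x⟩
      map_add' := fun x y => Subtype.ext (funext fun j => map_add (μ j) x y)
      map_smul' := fun t x => Subtype.ext (funext fun j => map_smul (μ j) t x) }
  refine ⟨P ∘ₗ Ultrapower.mk V Y ∘ₗ Λ, fun x => ?_⟩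
  -- As `P` fixes constant families, the error is the image under `P` of the class of the errors,
  -- bounded by `c * ‖x‖` for almost all `j`.
  have e : f x - (P ∘ₗ Ultrapower.mk V Y ∘ₗ Λ) x
      = P (Ultrapower.mk V Y ⟨fun j => f x - μ j x, ⟨_, hμ x⟩⟩) := by
    have h1 : f x = P (Ultrapower.diag V Y (f x)) := (LinearMap.congr_fun hP (f x)).symm
    conv_lhs => rw [h1]
    rw [LinearMap.comp_apply, LinearMap.comp_apply, ← map_sub]
    exact congrArg P (map_sub (Ultrapower.mk V Y) _ _).symm
  rw [e]
  refine (hM _).trans ?_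
  refine (mul_le_mul_of_nonneg_right (le_max_left M 0) (Ultrapower.norm_nonneg' _)).trans ?_
  exact mul_le_mul_of_nonneg_left (Ultrapower.norm_mk_le (hμ x)) (le_max_right _ _)

end Ultrasummand

/-! ### Boundedness in finite dimension. -/

section FiniteDimensional

variable {X : Type u} {Y : Type v} [AddCommGroup X] [Module ℝ X] [Norm X] [IsQuasinormed X]
  [AddCommGroup Y] [Module ℝ Y] [Norm Y] [IsQuasinormed Y]

theorem exists_norm_sum_smul_le {ι : Type*} (s : Finset ι) (v : ι → X) :
    ∃ M : ℝ, 0 ≤ M ∧ ∀ (a : ι → ℝ) (K : ℝ), 0 ≤ K → (∀ i, |a i| ≤ K) →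
      ‖∑ i ∈ s, a i • v i‖ ≤ M * K := by
  classical
  obtain ⟨Δ, h1, hΔ⟩ := exists_modulus X
  induction s using Finset.induction_on with
  | empty => exact ⟨0, le_rfl, fun a K _ _ => by simp [norm_zero']⟩
  | insert j s hj ih =>
    obtain ⟨M, hM, h⟩ := ih
    have p := IsQuasinormed.nonneg (v j)
    refine ⟨Δ * (‖v j‖ + M), by positivity, fun a K hK ha => ?_⟩
    rw [Finset.sum_insert hj]
    calc _ ≤ Δ * (‖a j • v j‖ + ‖∑ i ∈ s, a i • v i‖) := hΔ _ _
      _ ≤ Δ * (K * ‖v j‖ + M * K) := by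
        gcongr
        · rw [IsQuasinormed.smul]; exact mul_le_mul_of_nonneg_right (ha j) p
        · exact h a K hK ha
      _ = _ := by ring

/-- Homogeneity controls each multiple of a vector and the defect pays for each addition, so no
continuity of `f` is needed. -/
theorem exists_norm_map_sum_smul_le {f : X → Y} (hf : IsHomogeneous f) {Q : ℝ} (hQ : 0 ≤ Q)
    (hd : DefectLE f Q) {ι : Type*} (s : Finset ι) (v : ι → X) :
    ∃ M : ℝ, 0 ≤ M ∧ ∀ (a : ι → ℝ) (K : ℝ), 0 ≤ K → (∀ i, |a i| ≤ K) →
      ‖f (∑ i ∈ s, a i • v i)‖ ≤ M * K := by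
  classical
  obtain ⟨Δ, h1, hΔ⟩ := exists_modulus Y
  induction s using Finset.induction_on with
  | empty => exact ⟨0, le_rfl, fun a K _ _ => by simp [norm_zero', hf.map_zero]⟩
  | insert j s hj ih =>
    obtain ⟨M, hM, h⟩ := ih
    obtain ⟨M', hM', h'⟩ := exists_norm_sum_smul_le s v
    have p := IsQuasinormed.nonneg (v j)
    have p' := IsQuasinormed.nonneg (f (v j))
    refine ⟨Δ * (Q * (‖v j‖ + M') + Δ * (‖f (v j)‖ + M)), by positivity, fun a K hK ha => ?_⟩
    rw [Finset.sum_insert hj]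
    set S := ∑ i ∈ s, a i • v i
    have e : f (a j • v j + S) = (f (a j • v j + S) - f (a j • v j) - f S)
        + (f (a j • v j) + f S) := by abel
    have g1 : ‖a j • v j‖ ≤ K * ‖v j‖ := by
      rw [IsQuasinormed.smul]; exact mul_le_mul_of_nonneg_right (ha j) p
    have g2 : ‖f (a j • v j)‖ ≤ K * ‖f (v j)‖ := by
      rw [hf, IsQuasinormed.smul]; exact mul_le_mul_of_nonneg_right (ha j) p'
    calc _ = _ := congrArg _ e
      _ ≤ Δ * (‖f (a j • v j + S) - f (a j • v j) - f S‖ + ‖f (a j • v j) + f S‖) := hΔ _ _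
      _ ≤ Δ * (Q * (K * ‖v j‖ + M' * K) + Δ * (K * ‖f (v j)‖ + M * K)) := by
        gcongr
        · exact (hd _ _).trans (mul_le_mul_of_nonneg_left
            (add_le_add g1 (h' a K hK ha)) hQ)
        · exact (hΔ _ _).trans (mul_le_mul_of_nonneg_left
            (add_le_add g2 (h a K hK ha)) (by linarith))
      _ = _ := by ring

/-- Coordinates are bounded by the quasinorm in finite dimension. -/
theorem exists_norm_le_of_injective {n : ℕ} (φ : (Fin n → ℝ) →ₗ[ℝ] X)
    (hφ : Function.Injective φ) : ∃ c : ℝ, 0 ≤ c ∧ ∀ a, ‖a‖ ≤ c * ‖φ a‖ := by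
  obtain ⟨Δ, h1, hΔ⟩ := exists_modulus X
  obtain ⟨M, hM, hMφ⟩ : ∃ M : ℝ, 0 ≤ M ∧ ∀ a, ‖φ a‖ ≤ M * ‖a‖ := by
    obtain ⟨M, hM, h⟩ := exists_norm_sum_smul_le Finset.univ
      (fun i => φ fun j => if i = j then 1 else 0)
    refine ⟨M, hM, fun a => ?_⟩
    have := h a ‖a‖ (norm_nonneg a) (fun i => norm_le_pi_norm a i)
    rwa [LinearMap.pi_apply_eq_sum_univ φ a]
  by_contra! hcon
  have hseq : ∀ k : ℕ, ∃ a : Fin n → ℝ, ‖a‖ = 1 ∧ ‖φ a‖ ≤ 1 / ((k : ℝ) + 1) := by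
    intro k
    obtain ⟨a, ha⟩ := hcon (k + 1) (by positivity)
    have hpos : 0 < ‖a‖ := lt_of_le_of_lt
      (mul_nonneg (by positivity) (IsQuasinormed.nonneg (φ a))) ha
    refine ⟨‖a‖⁻¹ • a, ?_, ?_⟩
    · rw [norm_smul, norm_inv, norm_norm, inv_mul_cancel₀ hpos.ne']
    · rw [map_smul, IsQuasinormed.smul, abs_of_pos (inv_pos.2 hpos), inv_mul_le_iff₀ hpos,
        mul_one_div, le_div_iff₀ (by positivity)]
      linarith
  choose a ha1 ha2 using hseq
  -- A limit of unit vectors with images tending to zero is a unit vector in the kernel of `φ`.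
  obtain ⟨b, hb, ψ, hψ, hlim⟩ := (isCompact_sphere (0 : Fin n → ℝ) 1).tendsto_subseq
    (x := a) (fun k => by simp [ha1])
  have hb1 : ‖b‖ = 1 := by simpa using hb
  have hz : ‖φ b‖ ≤ 0 := by
    have l1 : Tendsto (fun k => 1 / ((ψ k : ℝ) + 1)) atTop (𝓝 0) :=
      tendsto_one_div_add_atTop_nhds_zero_nat.comp hψ.tendsto_atTop
    have l2 : Tendsto (fun k => ‖b - a (ψ k)‖) atTop (𝓝 0) := by
      have := (tendsto_const_nhds (x := b)).sub hlim
      simpa using this.norm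
    have l3 : Tendsto (fun k => Δ * (1 / ((ψ k : ℝ) + 1) + M * ‖b - a (ψ k)‖)) atTop (𝓝 0) := by
      simpa using (l1.add (l2.const_mul M)).const_mul Δ
    refine ge_of_tendsto l3 (Eventually.of_forall fun k => ?_)
    calc ‖φ b‖ = ‖φ (a (ψ k)) + φ (b - a (ψ k))‖ := by rw [← map_add]; simp
      _ ≤ Δ * (‖φ (a (ψ k))‖ + ‖φ (b - a (ψ k))‖) := hΔ _ _
      _ ≤ _ := mul_le_mul_of_nonneg_left (add_le_add (ha2 _) (hMφ _)) (by linarith)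
  have : b = 0 := hφ (by rw [eq_zero_of_norm_nonpos hz, map_zero])
  simp [this] at hb1

/-- Quasilinear maps are bounded on finite dimensional subspaces. -/
theorem exists_bound_of_finiteDimensional {f : X → Y} (hf : IsHomogeneous f) {Q : ℝ}
    (hQ : 0 ≤ Q) (hd : DefectLE f Q) (E : Submodule ℝ X) (hE : FiniteDimensional ℝ E) :
    ∃ M : ℝ, 0 ≤ M ∧ ∀ x ∈ E, ‖f x‖ ≤ M * ‖x‖ := by
  let b := Module.finBasis ℝ E
  let φ : (Fin (Module.finrank ℝ E) → ℝ) →ₗ[ℝ] X := E.subtype ∘ₗ b.equivFun.symm.toLinearMap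
  obtain ⟨c, hc, hφ⟩ := exists_norm_le_of_injective φ
    (E.injective_subtype.comp b.equivFun.symm.injective)
  obtain ⟨M, hM, h⟩ := exists_norm_map_sum_smul_le hf hQ hd Finset.univ (fun i => (b i : X))
  refine ⟨M * c, by positivity, fun x hx => ?_⟩
  have hx1 : φ (b.equivFun ⟨x, hx⟩) = x :=
    congrArg Subtype.val (b.equivFun.symm_apply_apply ⟨x, hx⟩)
  have hx2 : ∑ i, b.equivFun ⟨x, hx⟩ i • (b i : X) = x := by
    have := congrArg (E.subtype) (b.sum_equivFun ⟨x, hx⟩)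
    rwa [map_sum] at this
  have h3 := h (b.equivFun ⟨x, hx⟩) ‖b.equivFun ⟨x, hx⟩‖ (norm_nonneg _)
    (fun i => norm_le_pi_norm (b.equivFun ⟨x, hx⟩) i)
  have h4 := hφ (b.equivFun ⟨x, hx⟩)
  rw [hx1] at h4
  rw [hx2] at h3
  calc _ ≤ _ := h3
    _ ≤ M * (c * ‖x‖) := mul_le_mul_of_nonneg_left h4 hM
    _ = _ := by ring

theorem defectLE_linearMap (l : X →ₗ[ℝ] Y) : DefectLE l 0 := fun x y => by
  simp [norm_zero']

theorem exists_bound_linearMap_of_finiteDimensional (l : X →ₗ[ℝ] Y) (E : Submodule ℝ X)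
    (hE : FiniteDimensional ℝ E) : ∃ M : ℝ, 0 ≤ M ∧ ∀ x ∈ E, ‖l x‖ ≤ M * ‖x‖ :=
  exists_bound_of_finiteDimensional (isHomogeneous_linearMap l) le_rfl (defectLE_linearMap l) E hE

end FiniteDimensional

/-! ### Finite-rank operators that fix a subspace. -/

section BAP

variable {X : Type u} [AddCommGroup X] [Module ℝ X] [Norm X] [IsQuasinormed X]

/-- Under the BAP the approximating operators can be taken to fix the given subspace. -/
theorem HasBAP.exists_fixing (h : HasBAP X) :
    ∃ c : ℝ, 0 < c ∧ ∀ E : Submodule ℝ X, FiniteDimensional ℝ E →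
      ∃ t : X →ₗ[ℝ] X, FiniteDimensional ℝ (LinearMap.range t) ∧
        (∀ x, ‖t x‖ ≤ c * ‖x‖) ∧ ∀ x ∈ E, t x = x := by
  obtain ⟨c, hc, h⟩ := h
  obtain ⟨Δ, h1, hΔ⟩ := exists_modulus X
  refine ⟨Δ * (c + 1), by positivity, fun E hE => ?_⟩
  -- Any error below one makes `t₀` injective on `E`. Inverting it there gives a bounded projection
  -- `p` onto `E`, whose bound may depend on `E`.
  obtain ⟨t₀, hr₀, hb₀, he₀⟩ := h E hE (1 / 2) (by norm_num)
  have hinj : LinearMap.ker (t₀.domRestrict E) = ⊥ := by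
    rw [LinearMap.ker_eq_bot']
    intro x hx
    have h2 := he₀ x x.2
    rw [LinearMap.domRestrict_apply] at hx
    rw [hx, zero_sub, norm_neg'] at h2
    have h3 := IsQuasinormed.nonneg (x : X)
    exact Subtype.ext (eq_zero_of_norm_nonpos (by linarith))
  obtain ⟨π, hπ⟩ := (t₀.domRestrict E).exists_leftInverse_of_injective hinj
  obtain ⟨M, hM, hMb⟩ := exists_bound_linearMap_of_finiteDimensional (E.subtype ∘ₗ π)
    (LinearMap.range t₀) hr₀
  let p : X →ₗ[ℝ] X := E.subtype ∘ₗ π ∘ₗ t₀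
  have hpE : ∀ x, p x ∈ E := fun x => (π (t₀ x)).2
  have hpx : ∀ x ∈ E, p x = x := fun x hx =>
    congrArg Subtype.val (LinearMap.congr_fun hπ ⟨x, hx⟩)
  have hpb : ∀ x, ‖p x‖ ≤ M * c * ‖x‖ := fun x => by
    refine (hMb (t₀ x) (LinearMap.mem_range_self t₀ x)).trans ?_
    rw [mul_assoc]
    exact mul_le_mul_of_nonneg_left (hb₀ x) hM
  have hMc : 0 ≤ M * c := mul_nonneg hM (by linarith)
  -- The error is tuned to the bound of `p`: the correction `p - t ∘ p` has norm at most one, so the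
  -- final constant does not depend on `E`.
  obtain ⟨t, hr, hb, he⟩ := h E hE (1 / (M * c + 1)) (by positivity)
  refine ⟨t + (p - t ∘ₗ p), ?_, fun x => ?_, fun x hx => ?_⟩
  · have hle : LinearMap.range (t + (p - t ∘ₗ p)) ≤ LinearMap.range t ⊔ E := by
      rintro _ ⟨x, rfl⟩
      have e : (t + (p - t ∘ₗ p)) x = t (x - p x) + p x := by
        simp only [LinearMap.add_apply, LinearMap.sub_apply, LinearMap.comp_apply, map_sub]
        abel
      rw [e]
      exact Submodule.add_mem_sup (LinearMap.mem_range_self t _) (hpE x)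
    exact Submodule.finiteDimensional_of_le hle
  · have g : ‖p x - t (p x)‖ ≤ 1 * ‖x‖ := by
      rw [IsQuasinormed.norm_sub_comm]
      refine (he _ (hpE x)).trans ?_
      rw [one_div, inv_mul_le_iff₀ (by positivity)]
      have := IsQuasinormed.nonneg x
      linarith [hpb x]
    calc _ ≤ Δ * (‖t x‖ + ‖p x - t (p x)‖) := hΔ _ _
      _ ≤ Δ * (c * ‖x‖ + 1 * ‖x‖) := mul_le_mul_of_nonneg_left
          (add_le_add (hb x) g) (by linarith)
      _ = _ := by ring
  · simp [hpx x hx]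

end BAP

section BoundedQuasilinear

variable {X : Type u} {Y : Type v} [AddCommGroup X] [Module ℝ X] [Norm X] [IsQuasinormed X]
  [AddCommGroup Y] [Module ℝ Y] [Norm Y] [IsQuasinormed Y]

/-- Quasilinear maps from a `𝒦`-space into a finite dimensional space are trivial. -/
theorem IsKSpace.exists_isBoundedMap_sub (hX : IsKSpace X) {g : X → Y} (hg : IsHomogeneous g)
    {Q : ℝ} (hQ : DefectLE g Q) (R : Submodule ℝ Y) (hR : FiniteDimensional ℝ R)
    (hgR : ∀ x, g x ∈ R) : ∃ h : X →ₗ[ℝ] Y, IsBoundedMap (fun x => g x - h x) := by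
  let b := Module.finBasis ℝ R
  -- Algebraic extensions suffice, since the coordinates are only evaluated on `R`.
  have hφ : ∀ i, ∃ φ : Y →ₗ[ℝ] ℝ, ∀ y : R, φ y = b.repr y i := by
    intro i
    obtain ⟨φ, hφ⟩ := LinearMap.exists_extend (b.coord i)
    exact ⟨φ, fun y => LinearMap.congr_fun hφ y⟩
  choose φ hφ using hφ
  have hl : ∀ i, ∃ (l : X →ₗ[ℝ] ℝ) (M : ℝ), 0 ≤ M ∧ ∀ x, ‖φ i (g x) - l x‖ ≤ M * ‖x‖ := by
    intro i
    obtain ⟨M, hM, hMφ⟩ := exists_bound_linearMap_of_finiteDimensional (φ i) R hR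
    have hhom : IsHomogeneous (fun x => φ i (g x)) := fun t x => by simp only [hg t x, map_smul]
    refine (isTrivialMap_iff hhom).1 (isTrivialMap_of_approxK_lt_top hX _
      ⟨hhom, M * Q, fun x y => ?_⟩)
    rw [← map_sub, ← map_sub, mul_assoc]
    exact (hMφ _ (sub_mem (sub_mem (hgR _) (hgR _)) (hgR _))).trans
      (mul_le_mul_of_nonneg_left (hQ x y) hM)
  choose l N hN hl using hl
  obtain ⟨M, hM, hMb⟩ := exists_norm_sum_smul_le Finset.univ (fun i => (b i : Y))
  refine ⟨∑ i, (l i).smulRight (b i : Y), M * ∑ i, N i, fun x => ?_⟩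
  have hgx : g x = ∑ i, φ i (g x) • (b i : Y) := by
    have h := congrArg R.subtype (b.sum_repr ⟨g x, hgR x⟩)
    rw [map_sum] at h
    refine h.symm.trans (Finset.sum_congr rfl fun i _ => ?_)
    rw [map_smul, ← hφ i ⟨g x, hgR x⟩]
    rfl
  have e : g x - (∑ i, (l i).smulRight (b i : Y)) x = ∑ i, (φ i (g x) - l i x) • (b i : Y) := by
    conv_lhs => rw [hgx]
    simp only [LinearMap.sum_apply, LinearMap.smulRight_apply, sub_smul, Finset.sum_sub_distrib]
  have hx := IsQuasinormed.nonneg x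
  beta_reduce
  rw [e, mul_assoc]
  refine hMb _ _ (mul_nonneg (Finset.sum_nonneg fun i _ => hN i) hx) fun i => ?_
  exact (hl i x).trans (mul_le_mul_of_nonneg_right
    (Finset.single_le_sum (fun i _ => hN i) (Finset.mem_univ i)) hx)

end BoundedQuasilinear

/-! ### Uniform approximation of all quasilinear maps. -/

section Reduction

variable {X Y : Type u} [AddCommGroup X] [Module ℝ X] [Norm X] [IsQuasinormed X]
  [AddCommGroup Y] [Module ℝ Y] [Norm Y]

/-- Under the approximation hypotheses it is enough to approximate bounded quasilinear maps. -/
theorem approxK_lt_top_of_approxK₀_lt_top [IsQuasinormed Y] (hY : IsUltrasummand Y)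
    (hXY : HasBAP X ∨ (IsKSpace X ∧ HasBAP Y)) (h : approxK₀ X Y < ⊤) : approxK X Y < ⊤ := by
  obtain ⟨C, hC, h⟩ := approxK₀_lt_top_iff.1 h
  obtain ⟨D, hD, hL⟩ := hY.exists_linear_approx X
  rw [approxK_lt_top_iff]
  rcases hXY with hX | ⟨hX, hB⟩
  · obtain ⟨c, hc, ht⟩ := hX.exists_fixing
    refine ⟨D * (C * c), by positivity, fun f hf hd _ => ?_⟩
    obtain ⟨l, hl⟩ := hL f (C * c) fun s => by
      -- `f ∘ t` is bounded because `t` has finite rank, its defect is at most `c`, and it agrees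
      -- with `f` on `s`.
      obtain ⟨t, hr, htb, hts⟩ := ht (Submodule.span ℝ (s : Set X))
        (FiniteDimensional.span_of_finite ℝ s.finite_toSet)
      obtain ⟨M, hM, hMb⟩ := exists_bound_of_finiteDimensional hf zero_le_one hd _ hr
      obtain ⟨l, hl⟩ := UniformlyApproximable.approx (f := fun x => f (t x)) h
        (fun a x => by simp only [map_smul, hf a])
        ⟨M * c, fun x => by
          rw [mul_assoc]
          exact (hMb _ (LinearMap.mem_range_self t x)).trans
            (mul_le_mul_of_nonneg_left (htb x) hM)⟩ hc
        (fun x y => by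
          beta_reduce
          rw [map_add]
          refine (hd _ _).trans ?_
          linarith [htb x, htb y])
      refine ⟨l, fun x hx => ?_⟩
      have := hl x
      simp only [hts x (Submodule.subset_span hx)] at this
      exact this
    exact ⟨l, fun x => (hl x).trans (le_of_eq (by ring))⟩
  · obtain ⟨c, hc, ht⟩ := hB.exists_fixing
    refine ⟨D * (C * c), by positivity, fun f hf hd _ => ?_⟩
    obtain ⟨l, hl⟩ := hL f (C * c) fun s => by
      -- Now `t` acts on the target and fixes the values of `f` on `s`. The map `t ∘ f` has
      -- finite-dimensional range, so it is bounded up to a linear map `k`.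
      obtain ⟨t, hr, htb, hts⟩ := ht (Submodule.span ℝ (f '' (s : Set X)))
        (FiniteDimensional.span_of_finite ℝ (s.finite_toSet.image f))
      have hg : IsHomogeneous (fun x => t (f x)) := fun a x => by simp only [hf a, map_smul]
      have hgd : DefectLE (fun x => t (f x)) c := fun x y => by
        rw [← map_sub, ← map_sub]
        refine (htb _).trans ?_
        have := hd x y
        rw [one_mul] at this
        exact mul_le_mul_of_nonneg_left this hc.le
      obtain ⟨k, hk⟩ := hX.exists_isBoundedMap_sub hg hgd _ hr
        (fun x => LinearMap.mem_range_self t (f x))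
      obtain ⟨l, hl⟩ := UniformlyApproximable.approx h (hg.sub (isHomogeneous_linearMap k)) hk hc
        (hgd.sub_linearMap k)
      refine ⟨k + l, fun x hx => ?_⟩
      have := hl x
      rwa [hts (f x) (Submodule.subset_span ⟨x, hx, rfl⟩), sub_sub] at this
    exact ⟨l, fun x => (hl x).trans (le_of_eq (by ring))⟩

/-- Quasilinear maps that vanish on a Hamel basis are pointwise controlled by their defect. -/
theorem exists_pointwise_bound [IsQuasinormed Y] {ι : Type*} (b : Module.Basis ι ℝ X) (x : X) :
    ∃ K : ℝ, 0 ≤ K ∧ ∀ (g : X → Y) (Q : ℝ), IsHomogeneous g → 0 ≤ Q → DefectLE g Q →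
      (∀ i, g (b i) = 0) → ‖g x‖ ≤ K * Q := by
  obtain ⟨Δ, h1, hΔ⟩ := exists_modulus Y
  have hx : x ∈ Submodule.span ℝ (Set.range b) := by rw [b.span_eq]; trivial
  induction hx using Submodule.span_induction with
  | mem x hx =>
    obtain ⟨i, rfl⟩ := hx
    exact ⟨0, le_rfl, fun g Q _ _ _ h => by simp [h, norm_zero']⟩
  | zero => exact ⟨0, le_rfl, fun g Q hg _ _ _ => by simp [hg.map_zero, norm_zero']⟩
  | add x y _ _ hx hy =>
    obtain ⟨K, hK, hx⟩ := hx
    obtain ⟨K', hK', hy⟩ := hy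
    have p := IsQuasinormed.nonneg x
    have p' := IsQuasinormed.nonneg y
    refine ⟨Δ * ((‖x‖ + ‖y‖) + Δ * (K + K')), by positivity, fun g Q hg hQ hd hb => ?_⟩
    have e : g (x + y) = (g (x + y) - g x - g y) + (g x + g y) := by abel
    calc ‖g (x + y)‖ = _ := congrArg _ e
      _ ≤ Δ * (‖g (x + y) - g x - g y‖ + ‖g x + g y‖) := hΔ _ _
      _ ≤ Δ * (Q * (‖x‖ + ‖y‖) + Δ * (K * Q + K' * Q)) := by
        gcongr
        · exact hd x y
        · exact (hΔ _ _).trans (mul_le_mul_of_nonneg_left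
            (add_le_add (hx g Q hg hQ hd hb) (hy g Q hg hQ hd hb)) (by linarith))
      _ = _ := by ring
  | smul t x _ hx =>
    obtain ⟨K, hK, hx⟩ := hx
    refine ⟨|t| * K, by positivity, fun g Q hg hQ hd hb => ?_⟩
    rw [hg, IsQuasinormed.smul, mul_assoc]
    exact mul_le_mul_of_nonneg_left (hx g Q hg hQ hd hb) (abs_nonneg t)

/-- If no uniform approximation is possible, there are quasilinear maps with small defect that
vanish on a Hamel basis and are far from linear maps. -/
theorem exists_far_from_linear [IsQuasinormed Y] {ι : Type*} (b : Module.Basis ι ℝ X)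
    (h : ¬ approxK X Y < ⊤) {δ : ℝ} (hδ : 0 < δ) (n : ℕ) :
    ∃ g : X → Y, IsHomogeneous g ∧ DefectLE g δ ∧ (∀ i, g (b i) = 0) ∧
      ∀ l : X →ₗ[ℝ] Y, ∃ x, n * ‖x‖ < ‖g x - l x‖ := by
  rw [approxK_lt_top_iff, UniformlyApproximable] at h
  push Not at h
  obtain ⟨f, hf, hd, -, hfl⟩ := h (n * δ⁻¹) (by positivity)
  -- Subtracting the linear interpolant of `f` on the basis changes neither the defect nor the
  -- distance to linear maps.
  let l₀ : X →ₗ[ℝ] Y := b.constr ℝ fun i => f (b i)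
  refine ⟨fun x => δ • (f x - l₀ x), (hf.sub (isHomogeneous_linearMap l₀)).const_smul δ, ?_,
    fun i => ?_, fun l => ?_⟩
  · have := (hd.sub_linearMap l₀).const_smul δ
    rwa [mul_one, abs_of_pos hδ] at this
  · simp [l₀, b.constr_basis]
  · obtain ⟨x, hx⟩ := hfl (l₀ + δ⁻¹ • l)
    refine ⟨x, ?_⟩
    have e : δ • (f x - l₀ x) - l x = δ • (f x - (l₀ + δ⁻¹ • l) x) := by
      rw [LinearMap.add_apply, LinearMap.smul_apply, ← sub_sub, smul_sub δ (f x - l₀ x),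
        smul_inv_smul₀ hδ.ne']
    rw [e, IsQuasinormed.smul, abs_of_pos hδ]
    calc n * ‖x‖ = δ * (n * δ⁻¹ * ‖x‖) := by field_simp
      _ < _ := mul_lt_mul_of_pos_left hx hδ

/-- A uniform boundedness principle for quasilinear maps. -/
theorem approxK_lt_top_of_isTrivialMap [IsQuasiBanach Y] (hY : IsUltrasummand Y)
    (h : ∀ f : X → Y, IsQuasilinear f → IsTrivialMap f) : approxK X Y < ⊤ := by
  by_contra hcon
  obtain ⟨D, hD, hL⟩ := hY.exists_linear_approx X
  obtain ⟨Δ, h1, hΔ⟩ := exists_modulus Y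
  set ρ : ℝ := (2 * Δ)⁻¹ with hρ
  have hρ0 : 0 < ρ := by positivity
  let b := Module.Basis.ofVectorSpace ℝ X
  choose g hg hgd hgb hgl using fun n : ℕ => exists_far_from_linear b hcon (pow_pos hρ0 n) n
  choose K hK hKb using fun x : X => exists_pointwise_bound (Y := Y) b x
  have hsum : ∀ (c : ℕ → Bool) (x : X), ∃ s : Y,
      QTendsto (fun n => ∑ k ∈ Finset.range n, subterm c (fun k => g k x) k) s ∧
      ∀ m, ‖s - ∑ k ∈ Finset.range m, subterm c (fun k => g k x) k‖
        ≤ Δ * (2 * Δ * (K x * ρ ^ m)) := by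
    intro c x
    refine exists_qTendsto_sum h1 hΔ _ (hK x) fun k => ?_
    exact (norm_subterm_le c _ k).trans
      (hKb x (g k) _ (hg k) (by positivity) (hgd k) (hgb k))
  choose H hH hHm using hsum
  have hHhom : ∀ c, IsHomogeneous (H c) := by
    intro c t x
    refine (hH c (t • x)).unique ?_
    have := (hH c x).smul t
    refine this.congr_eventually (Eventually.of_forall fun n => ?_)
    rw [Finset.smul_sum]
    refine Finset.sum_congr rfl fun k _ => ?_
    unfold subterm
    split_ifs
    · exact (hg k t x).symm
    · rw [smul_zero]
  have hHq : ∀ c, IsQuasilinear (H c) := by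
    intro c
    refine ⟨hHhom c, Δ * (2 * Δ), fun x y => ?_⟩
    have hlim := ((hH c (x + y)).sub (hH c x)).sub (hH c y)
    have hb := hlim.norm_le h1 hΔ (M := 2 * Δ * (‖x‖ + ‖y‖)) (Eventually.of_forall fun n => by
      rw [← Finset.sum_sub_distrib, ← Finset.sum_sub_distrib]
      refine norm_sum_range_le_of_geometric h1 hΔ n _
        (add_nonneg (IsQuasinormed.nonneg x) (IsQuasinormed.nonneg y)) fun k => ?_
      have e : subterm c (fun k => g k (x + y)) k - subterm c (fun k => g k x) k
          - subterm c (fun k => g k y) k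
          = subterm c (fun k => g k (x + y) - g k x - g k y) k := by
        unfold subterm; split_ifs <;> simp
      rw [e, mul_comm]
      exact (norm_subterm_le c _ k).trans (hgd k x y))
    linarith
  obtain ⟨N, n₀, hN⟩ := exists_pair_differing_at
    (fun N => {c | ∃ l : X →ₗ[ℝ] Y, ∀ x, ‖H c x - l x‖ ≤ N * ‖x‖}) (by
      intro c
      obtain ⟨l, M, hM, hl⟩ := (isTrivialMap_iff (hHhom c)).1 (h _ (hHq c))
      obtain ⟨N, hN⟩ := exists_nat_ge M
      exact ⟨N, l, fun x => (hl x).trans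
        (mul_le_mul_of_nonneg_right hN (IsQuasinormed.nonneg x))⟩)
  -- The `1` bounds the truncation error and each `N` one linear approximation. What matters is that
  -- `c₀` does not involve `n`.
  set c₀ : ℝ := Δ * (1 + Δ * (N + N)) with hc₀
  obtain ⟨n₁, hn₁⟩ := exists_nat_ge (D * c₀)
  set n := max n₀ n₁
  obtain ⟨l, hl⟩ := hL (g n) c₀ fun s => by
    have hlim : ∀ x, Tendsto (fun m : ℕ => Δ * (Δ * (2 * Δ * (K x * ρ ^ m))
        + Δ * (2 * Δ * (K x * ρ ^ m)))) atTop (𝓝 0) := by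
      intro x
      have : Tendsto (fun m : ℕ => ρ ^ m) atTop (𝓝 0) :=
        tendsto_pow_atTop_nhds_zero_of_lt_one hρ0.le (inv_lt_one_of_one_lt₀ (by linarith))
      have h := (((this.const_mul (K x)).const_mul (2 * Δ)).const_mul Δ)
      simpa using (h.add h).const_mul Δ
    -- The tails are small only pointwise, so `m`, and with it the pair of subseries, depends on the
    -- finite set `s`.
    have hev : ∀ᶠ m : ℕ in atTop, ∀ x ∈ s, x ≠ 0 → Δ * (Δ * (2 * Δ * (K x * ρ ^ m))
        + Δ * (2 * Δ * (K x * ρ ^ m))) < ‖x‖ := by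
      rw [eventually_all_finset]
      intro x _
      by_cases hx : x = 0
      · simp [hx]
      · filter_upwards [(hlim x).eventually_lt_const (norm_pos hx)] with m hm _
        exact hm
    obtain ⟨m, hm1, hm2⟩ := (hev.and (eventually_gt_atTop n)).exists
    obtain ⟨c, ⟨l, hl⟩, c', ⟨l', hl'⟩, hcn, hcn', hk⟩ := hN n (le_max_left _ _) m
    refine ⟨l - l', fun x hx => ?_⟩
    by_cases hx0 : x = 0
    · simp [hx0, (hg n).map_zero, norm_zero']
    have g1 := (norm_sub_subseries_le (x := fun k => g k x) h1 hΔ (hHm c x m) (hHm c' x m)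
      hm2 hcn hcn' hk).trans (hm1 x hx hx0).le
    have e : g n x - (l - l') x = (g n x - (H c x - H c' x))
        + ((H c x - l x) - (H c' x - l' x)) := by
      rw [LinearMap.sub_apply]; abel
    rw [e]
    calc _ ≤ Δ * (‖g n x - (H c x - H c' x)‖ + ‖(H c x - l x) - (H c' x - l' x)‖) := hΔ _ _
      _ ≤ Δ * (‖x‖ + Δ * (N * ‖x‖ + N * ‖x‖)) := by
        gcongr
        exact (sub_le_of_modulus hΔ _ _).trans (mul_le_mul_of_nonneg_left
          (add_le_add (hl x) (hl' x)) (by linarith))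
      _ = _ := by rw [hc₀]; ring
  obtain ⟨x, hx⟩ := hgl n l
  refine absurd hx (not_lt.2 ((hl x).trans ?_))
  rw [← mul_assoc]
  refine mul_le_mul_of_nonneg_right (hn₁.trans ?_) (IsQuasinormed.nonneg x)
  exact_mod_cast le_max_right n₀ n₁

end Reduction

/-! ### Accessible operators and asymptotically linear families. -/

section Families

variable {I : Type w} {U : Ultrafilter I} {X : Type u} [AddCommGroup X] [Module ℝ X] [Norm X]
  [IsQuasinormed X]

theorem infinitesimalFamilies_le : infinitesimalFamilies U X ≤ finiteFamilies U X := by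
  intro x hx
  exact ⟨1, (Tendsto.eventually_lt_const one_pos hx).mono fun i hi => hi.le⟩

theorem mem_finiteFamilies_of_tendsto (x : finiteFamilies U X) {y : I → X}
    (h : Tendsto (fun i => ‖x.1 i - y i‖) (U : Filter I) (𝓝 0)) : y ∈ finiteFamilies U X := by
  have h1 : x.1 - y ∈ finiteFamilies U X := infinitesimalFamilies_le h
  have h2 := sub_mem x.2 h1
  rwa [sub_sub_cancel] at h2

theorem tendsto_mul_norm_of_finite {a : I → ℝ} (ha : Tendsto a (U : Filter I) (𝓝 0))
    (x : finiteFamilies U X) : Tendsto (fun i => a i * ‖x.1 i‖) (U : Filter I) (𝓝 0) := by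
  obtain ⟨r, hr⟩ := Ultrapower.exists_tendsto_norm x
  simpa using ha.mul hr

theorem tendsto_norm_smul_sub_smul {a : I → ℝ} {t : ℝ} (ha : Tendsto a (U : Filter I) (𝓝 t))
    (x : finiteFamilies U X) :
    Tendsto (fun i => ‖(t • x).1 i - a i • x.1 i‖) (U : Filter I) (𝓝 0) := by
  have h1 : Tendsto (fun i => |t - a i|) (U : Filter I) (𝓝 0) := by
    simpa using ((tendsto_const_nhds (x := t)).sub ha).abs
  refine (tendsto_mul_norm_of_finite h1 x).congr fun i => ?_
  have e : (t • x).1 i - a i • x.1 i = (t - a i) • x.1 i := (sub_smul t (a i) (x.1 i)).symm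
  rw [e, IsQuasinormed.smul]

end Families

section Accessible

variable {I : Type w} {U : Ultrafilter I} {X : Type u} {Y : Type v}
  [AddCommGroup X] [Module ℝ X] [Norm X] [IsQuasinormed X]
  [AddCommGroup Y] [Module ℝ Y] [Norm Y] [IsQuasinormed Y]

theorem IsInducedBy.congr_of_tendsto {F : Ultrapower U X → Ultrapower U Y} {f g : I → X → Y}
    (hf : IsInducedBy F f) (h : ∀ x : finiteFamilies U X,
      Tendsto (fun i => ‖f i (x.1 i) - g i (x.1 i)‖) (U : Filter I) (𝓝 0)) :
    IsInducedBy F g := by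
  intro x
  obtain ⟨hx, hF⟩ := hf x
  have hg := mem_finiteFamilies_of_tendsto ⟨_, hx⟩ (h x)
  exact ⟨hg, hF.trans (Ultrapower.mk_eq_mk_iff.2 (h x))⟩

/-- Accessible linear maps are induced by homogeneous maps. -/
theorem exists_homogeneous_inducing (T : Ultrapower U X →ₗ[ℝ] Ultrapower U Y)
    (hT : IsAccessible T) : ∃ g : I → X → Y, (∀ i, IsHomogeneous (g i)) ∧ IsInducedBy T g := by
  obtain ⟨f, hf⟩ := hT
  obtain ⟨e, τ, h1, h2, h3, h4, h5⟩ := exists_polar_decomposition X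
  refine ⟨fun i x => τ x • f i (e x), fun i => isHomogeneous_of_polar h4 h5 (f i), fun x => ?_⟩
  let ex : finiteFamilies U X := ⟨fun i => e (x.1 i), 1, Eventually.of_forall fun i => h3 _⟩
  obtain ⟨hfe, hTe⟩ := hf ex
  obtain ⟨t, ht⟩ : ∃ t : ℝ, Tendsto (fun i => τ (x.1 i)) (U : Filter I) (𝓝 t) := by
    obtain ⟨M, hM⟩ := x.2
    have h : Set.Icc (-M) M ∈ U.map (fun i => τ (x.1 i)) := by
      rw [Ultrafilter.mem_map]
      exact hM.mono fun i hi => abs_le.1 ((h2 _).trans_le hi)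
    obtain ⟨r, -, hr⟩ := isCompact_Icc.ultrafilter_le_nhds' _ h
    exact ⟨r, hr⟩
  -- The coordinates converge along `U`, so in the ultrapower they act as one scalar, which the
  -- linear map `T` carries through.
  have hx : Ultrapower.mk U X x = t • Ultrapower.mk U X ex := by
    rw [← map_smul, eq_comm, Ultrapower.mk_eq_mk_iff]
    refine (tendsto_norm_smul_sub_smul ht ex).congr fun i => ?_
    rw [show τ (x.1 i) • ex.1 i = x.1 i from h1 _]
  have hy := tendsto_norm_smul_sub_smul ht ⟨_, hfe⟩
  refine ⟨mem_finiteFamilies_of_tendsto _ hy, ?_⟩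
  rw [hx, map_smul, hTe, ← map_smul]
  exact Ultrapower.mk_eq_mk_iff.2 hy

/-- The maps inducing a bounded map are uniformly bounded. -/
theorem exists_eventually_bound {T : Ultrapower U X →ₗ[ℝ] Ultrapower U Y} (hT : IsBoundedMap T)
    {g : I → X → Y} (hg : ∀ i, IsHomogeneous (g i)) (hTg : IsInducedBy T g) :
    ∃ M : ℝ, ∀ᶠ i in (U : Filter I), ∀ x, ‖g i x‖ ≤ M * ‖x‖ := by
  obtain ⟨N, hN⟩ := hT
  obtain ⟨Δ, h1, hΔ⟩ := exists_modulus Y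
  -- Chosen so that violating vectors of norm at most one, collected into a family, would contradict
  -- the bound for `T`.
  set M := Δ * (|N| + 1 + 1)
  have hsel : ∀ i, ∃ x : X, ‖x‖ ≤ 1 ∧ ((∀ x, ‖g i x‖ ≤ M * ‖x‖) ∨ M < ‖g i x‖) := by
    intro i
    by_cases h : ∀ x, ‖g i x‖ ≤ M * ‖x‖
    · exact ⟨0, by simp [norm_zero'], Or.inl h⟩
    · push Not at h
      obtain ⟨x, hx⟩ := h
      have hx0 : x ≠ 0 := by
        rintro rfl
        simp [(hg i).map_zero, norm_zero'] at hx
      have hp := norm_pos hx0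
      refine ⟨‖x‖⁻¹ • x, (norm_inv_smul hx0).le, Or.inr ?_⟩
      rw [hg i, IsQuasinormed.smul, abs_of_pos (inv_pos.2 hp), lt_inv_mul_iff₀ hp]
      linarith
  choose x hx1 hx2 using hsel
  obtain ⟨hgx, hTx⟩ := hTg ⟨x, 1, Eventually.of_forall hx1⟩
  have hlt : ‖Ultrapower.mk U Y ⟨fun i => g i (x i), hgx⟩‖ < |N| + 1 := by
    rw [← hTx]
    refine lt_of_le_of_lt (hN _) (lt_of_le_of_lt ?_ (lt_add_one _))
    refine (mul_le_mul_of_nonneg_right (le_abs_self N) (Ultrapower.norm_nonneg' _)).trans ?_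
    refine (mul_le_mul_of_nonneg_left ?_ (abs_nonneg N)).trans (mul_one _).le
    exact Ultrapower.norm_mk_le (Eventually.of_forall hx1)
  refine ⟨M, ?_⟩
  filter_upwards [Ultrapower.eventually_le_of_norm_mk_lt h1 hΔ hlt] with i hi
  exact (hx2 i).resolve_right (not_lt.2 hi)

/-- The maps inducing a linear map are asymptotically linear. -/
theorem eventually_defectLE {T : Ultrapower U X →ₗ[ℝ] Ultrapower U Y} {g : I → X → Y}
    (hg : ∀ i, IsHomogeneous (g i)) (hTg : IsInducedBy T g) {ε : ℝ} (hε : 0 < ε) :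
    ∀ᶠ i in (U : Filter I), DefectLE (g i) ε := by
  have hsel : ∀ i, ∃ x y : X, ‖x‖ ≤ 1 ∧ ‖y‖ ≤ 1 ∧
      (DefectLE (g i) ε ∨ ε < ‖g i (x + y) - g i x - g i y‖) := by
    intro i
    by_cases h : DefectLE (g i) ε
    · exact ⟨0, 0, by simp [norm_zero'], by simp [norm_zero'], Or.inl h⟩
    · unfold DefectLE at h
      push Not at h
      obtain ⟨x, y, hxy⟩ := h
      have px := IsQuasinormed.nonneg x
      have py := IsQuasinormed.nonneg y
      have hp : 0 < ‖x‖ + ‖y‖ := by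
        refine lt_of_le_of_ne (by positivity) fun h0 => ?_
        have hx0 : x = 0 := eq_zero_of_norm_nonpos (by linarith)
        have hy0 : y = 0 := eq_zero_of_norm_nonpos (by linarith)
        simp [hx0, hy0, (hg i).map_zero, norm_zero'] at hxy
      set r := (‖x‖ + ‖y‖)⁻¹ with hr
      have hr0 : 0 < r := inv_pos.2 hp
      refine ⟨r • x, r • y, ?_, ?_, Or.inr ?_⟩
      · rw [IsQuasinormed.smul, abs_of_pos hr0, inv_mul_le_iff₀ hp]; linarith
      · rw [IsQuasinormed.smul, abs_of_pos hr0, inv_mul_le_iff₀ hp]; linarith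
      · rw [← smul_add, hg i, hg i, hg i, ← smul_sub, ← smul_sub, IsQuasinormed.smul,
          abs_of_pos hr0, lt_inv_mul_iff₀ hp]
        linarith
  choose x y hx hy hxy using hsel
  let fx : finiteFamilies U X := ⟨x, 1, Eventually.of_forall hx⟩
  let fy : finiteFamilies U X := ⟨y, 1, Eventually.of_forall hy⟩
  obtain ⟨hgx, hTx⟩ := hTg fx
  obtain ⟨hgy, hTy⟩ := hTg fy
  obtain ⟨hgxy, hTxy⟩ := hTg (fx + fy)
  have h := hTxy.symm
  rw [map_add, map_add, hTx, hTy, ← map_add, Ultrapower.mk_eq_mk_iff] at h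
  filter_upwards [h.eventually_lt_const hε] with i hi
  refine (hxy i).resolve_right (not_lt.2 (le_of_eq_of_le ?_ hi.le))
  rw [sub_sub]
  rfl

/-- The linear map chosen near `g i` is at distance at most `C * Q[g i]`, which tends to zero along
`U`, so both families induce the same operator. -/
theorem isUltraproductOfOperators_of_approxK₀_lt_top (h : approxK₀ X Y < ⊤)
    (T : Ultrapower U X →ₗ[ℝ] Ultrapower U Y) (hT : IsBoundedMap T) (hTa : IsAccessible T) :
    IsUltraproductOfOperators T := by
  obtain ⟨C, hC, hCtop⟩ := sInf_lt_iff.1 h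
  obtain ⟨g, hg, hTg⟩ := exists_homogeneous_inducing T hTa
  obtain ⟨M, hM⟩ := exists_eventually_bound hT hg hTg
  obtain ⟨Δ, h1, hΔ⟩ := exists_modulus Y
  have hsel : ∀ i, ∃ t : X →ₗ[ℝ] Y, IsBoundedMap t ∧
      (IsQuasilinear (g i) → IsBoundedMap (g i) →
        homNorm (fun x => g i x - t x) ≤ C * quasilinConst (g i)) := by
    intro i
    by_cases hi : IsQuasilinear (g i) ∧ IsBoundedMap (g i)
    · obtain ⟨t, ht⟩ := hC (g i) hi.1 hi.2
      refine ⟨t, ?_, fun _ _ => ht⟩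
      have hlt := ht.trans_lt (ENNReal.mul_lt_top hCtop hi.1.quasilinConst_ne_top.lt_top)
      have hb := (homNorm_le_iff ((hg i).sub (isHomogeneous_linearMap t))
        ENNReal.toReal_nonneg).1 (ENNReal.ofReal_toReal hlt.ne).ge
      obtain ⟨N, hN⟩ := hi.2
      refine ⟨Δ * (N + (homNorm fun x => g i x - t x).toReal), fun x => ?_⟩
      calc ‖t x‖ = ‖g i x - (g i x - t x)‖ := by simp
        _ ≤ Δ * (‖g i x‖ + ‖g i x - t x‖) := sub_le_of_modulus hΔ _ _
        _ ≤ Δ * (N * ‖x‖ + _ * ‖x‖) :=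
          mul_le_mul_of_nonneg_left (add_le_add (hN x) (hb x)) (by linarith)
        _ = _ := by ring
    -- The default value is harmless: almost every `g i` is quasilinear and bounded.
    · exact ⟨0, ⟨0, fun x => by simp [norm_zero']⟩, fun h1 h2 => absurd ⟨h1, h2⟩ hi⟩
  choose t ht1 ht2 using hsel
  have hclose : ∀ ε : ℝ, 0 < ε → ∀ᶠ i in (U : Filter I), ∀ x,
      ‖g i x - t i x‖ ≤ C.toReal * ε * ‖x‖ := by
    intro ε hε
    filter_upwards [eventually_defectLE hg hTg hε, hM] with i hi hMi
    have hle := ht2 i ⟨hg i, ε, hi⟩ ⟨M, hMi⟩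
    refine (homNorm_le_iff ((hg i).sub (isHomogeneous_linearMap (t i))) (by positivity)).1
      (hle.trans ?_)
    rw [ENNReal.ofReal_mul ENNReal.toReal_nonneg, ENNReal.ofReal_toReal hCtop.ne]
    gcongr
    exact quasilinConst_le hε.le hi
  refine ⟨t, ht1, hTg.congr_of_tendsto fun x => ?_⟩
  obtain ⟨N, hN⟩ := x.2
  rw [Metric.tendsto_nhds]
  intro ε hε
  have hδ : 0 < ε / ((C.toReal + 1) * (|N| + 1)) := by positivity
  filter_upwards [hclose _ hδ, hN] with i hi hNi
  rw [Real.dist_eq, sub_zero, abs_of_nonneg (IsQuasinormed.nonneg _)]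
  calc _ ≤ C.toReal * (ε / ((C.toReal + 1) * (|N| + 1))) * ‖x.1 i‖ := hi _
    _ ≤ C.toReal * (ε / ((C.toReal + 1) * (|N| + 1))) * (|N| + 1) :=
      mul_le_mul_of_nonneg_left (by linarith [le_abs_self N]) (by positivity)
    _ = ε * (C.toReal / (C.toReal + 1)) := by field_simp
    _ < ε * 1 := by
      refine mul_lt_mul_of_pos_left ?_ hε
      rw [div_lt_one (by positivity)]
      linarith
    _ = ε := mul_one ε

/-- If bounded quasilinear maps are not uniformly approximable, there are uniformly bounded ones
with arbitrarily small defect that stay away from linear maps. -/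
theorem exists_bounded_far_from_linear (h : ¬ approxK₀ X Y < ⊤) (n : ℕ) :
    ∃ g : X → Y, IsHomogeneous g ∧ DefectLE g (1 / ((n : ℝ) + 1)) ∧ (∀ x, ‖g x‖ ≤ 2 * ‖x‖) ∧
      ∀ l : X →ₗ[ℝ] Y, ∃ x, 1 / 2 * ‖x‖ < ‖g x - l x‖ := by
  rw [approxK₀_lt_top_iff, UniformlyApproximable] at h
  push Not at h
  obtain ⟨f, hf, hd, hb, hfl⟩ := h (n + 1) (by positivity)
  let S : Set ℝ := {M | ∃ l : X →ₗ[ℝ] Y, ∀ x, ‖f x - l x‖ ≤ M * ‖x‖}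
  have hS : ∀ M ∈ S, (n : ℝ) + 1 ≤ M := by
    rintro M ⟨l, hl⟩
    obtain ⟨x, hx⟩ := hfl l
    by_contra! hlt
    exact absurd (hx.trans_le (hl x))
      (not_lt.2 (mul_le_mul_of_nonneg_right hlt.le (IsQuasinormed.nonneg x)))
  have hSne : S.Nonempty := by
    obtain ⟨M, hM⟩ := hb
    exact ⟨M, 0, fun x => by simpa using hM x⟩
  have hSb : BddBelow S := ⟨_, hS⟩
  -- The distance from `f` to the linear maps. The infimum need not be attained, hence the factors
  -- `2` and `1 / 2` after division by `D`.
  set D := sInf S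
  have hD : (n : ℝ) + 1 ≤ D := le_csInf hSne hS
  have hD0 : 0 < D := lt_of_lt_of_le (by positivity) hD
  obtain ⟨M, ⟨l₀, hl₀⟩, hMD⟩ := exists_lt_of_csInf_lt hSne (show sInf S < 2 * D by linarith)
  refine ⟨fun x => D⁻¹ • (f x - l₀ x), (hf.sub (isHomogeneous_linearMap l₀)).const_smul _,
    ?_, fun x => ?_, fun l => ?_⟩
  · refine ((hd.sub_linearMap l₀).const_smul D⁻¹).mono ?_
    rw [mul_one, abs_of_pos (inv_pos.2 hD0), one_div]
    exact inv_anti₀ (by positivity) hD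
  · rw [IsQuasinormed.smul, abs_of_pos (inv_pos.2 hD0), inv_mul_le_iff₀ hD0]
    refine (hl₀ x).trans ?_
    have := mul_le_mul_of_nonneg_right hMD.le (IsQuasinormed.nonneg x)
    linarith
  · by_contra! hl
    have : 1 / 2 * D ∈ S := by
      refine ⟨l₀ + D • l, fun x => ?_⟩
      have e : f x - (l₀ + D • l) x = D • (D⁻¹ • (f x - l₀ x) - l x) := by
        rw [smul_sub, smul_inv_smul₀ hD0.ne', LinearMap.add_apply, LinearMap.smul_apply, sub_sub]
      rw [e, IsQuasinormed.smul, abs_of_pos hD0]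
      have := mul_le_mul_of_nonneg_left (hl x) hD0.le
      linarith
    have := csInf_le hSb this
    change D ≤ _ at this
    linarith

/-- Let `ν i` be the first `k` with `i ∉ S k`. Then `k ≤ ν i` on the intersection of the first `k`
sets, which belongs to `U`. -/
theorem CountablyIncomplete.exists_tendsto_atTop (hU : CountablyIncomplete U) :
    ∃ ν : I → ℕ, Tendsto ν (U : Filter I) atTop := by
  classical
  obtain ⟨S, hS, hSe⟩ := hU
  have hex : ∀ i, ∃ k, i ∉ S k := by
    intro i
    by_contra! h
    have : i ∈ ⋂ n, S n := Set.mem_iInter.2 h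
    rw [hSe] at this
    exact this
  refine ⟨fun i => Nat.find (hex i), tendsto_atTop.2 fun k => ?_⟩
  have : ∀ᶠ i in (U : Filter I), ∀ j ∈ Finset.range k, i ∈ S j :=
    (eventually_all_finset _).2 fun j _ => hS j
  filter_upwards [this] with i hi
  rw [Nat.le_find_iff]
  intro m hm
  exact not_not.2 (hi m (Finset.mem_range.2 hm))

/-- Uniformly bounded, asymptotically linear families of homogeneous maps induce operators. -/
theorem exists_operator_of_asymptotically_linear {G : I → X → Y} {ε : I → ℝ}
    (hG : ∀ i, IsHomogeneous (G i)) (hε : Tendsto ε (U : Filter I) (𝓝 0))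
    (hd : ∀ i, DefectLE (G i) (ε i)) {M : ℝ} (hM0 : 0 ≤ M) (hM : ∀ i x, ‖G i x‖ ≤ M * ‖x‖) :
    ∃ T : Ultrapower U X →ₗ[ℝ] Ultrapower U Y, IsBoundedMap T ∧ IsInducedBy T G := by
  obtain ⟨Δ, h1, hΔ⟩ := exists_modulus Y
  have hfin : ∀ x : finiteFamilies U X, (fun i => G i (x.1 i)) ∈ finiteFamilies U Y := by
    rintro ⟨x, N, hN⟩
    exact ⟨M * N, hN.mono fun i hi => (hM i _).trans (mul_le_mul_of_nonneg_left hi hM0)⟩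
  let γ : finiteFamilies U X → Ultrapower U Y := fun x =>
    Ultrapower.mk U Y ⟨fun i => G i (x.1 i), hfin x⟩
  have hdef : ∀ x y : finiteFamilies U X, Tendsto (fun i =>
      ‖G i (x.1 i + y.1 i) - G i (x.1 i) - G i (y.1 i)‖) (U : Filter I) (𝓝 0) := by
    intro x y
    have h := (tendsto_mul_norm_of_finite hε x).add (tendsto_mul_norm_of_finite hε y)
    rw [add_zero] at h
    refine squeeze_zero (fun _ => IsQuasinormed.nonneg _) (fun i => ?_) h
    rw [← mul_add]
    exact hd i _ _
  have hadd : ∀ x y, γ (x + y) = γ x + γ y := by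
    intro x y
    refine Eq.trans ?_ (map_add (Ultrapower.mk U Y) _ _)
    rw [Ultrapower.mk_eq_mk_iff]
    refine (hdef x y).congr fun i => ?_
    rw [sub_sub]
    rfl
  let Γ : finiteFamilies U X →ₗ[ℝ] Ultrapower U Y :=
    { toFun := γ
      map_add' := hadd
      map_smul' := fun t x => by
        refine Eq.trans ?_ (map_smul (Ultrapower.mk U Y) t _)
        refine congrArg (Ultrapower.mk U Y) (Subtype.ext (funext fun i => ?_))
        exact hG i t (x.1 i) }
  have hker : (infinitesimalFamilies U X).submoduleOf (finiteFamilies U X)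
      ≤ LinearMap.ker Γ := by
    intro x hx
    rw [LinearMap.mem_ker]
    refine Eq.trans ?_ (map_zero (Ultrapower.mk U Y))
    refine Ultrapower.mk_eq_mk_iff.2 ?_
    have hx' : Tendsto (fun i => ‖x.1 i‖) (U : Filter I) (𝓝 0) := hx
    have h : Tendsto (fun i => M * ‖x.1 i‖) (U : Filter I) (𝓝 0) := by
      simpa using hx'.const_mul M
    refine squeeze_zero (fun _ => IsQuasinormed.nonneg _) (fun i => ?_) h
    simpa using hM i (x.1 i)
  let T : Ultrapower U X →ₗ[ℝ] Ultrapower U Y := Submodule.liftQ _ Γ hker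
  have hT : ∀ x, T (Ultrapower.mk U X x) = γ x := fun x => Submodule.liftQ_apply _ Γ x
  refine ⟨T, ⟨M, fun z => ?_⟩, fun x => ⟨hfin x, hT x⟩⟩
  -- The infimum defining `‖z‖` may not be attained, so the bound is obtained for larger `r` and
  -- passed to the limit.
  have hr : ∀ r, ‖z‖ < r → ‖T z‖ ≤ M * r := by
    intro r hr
    obtain ⟨x, rfl, hx⟩ := Ultrapower.exists_rep_of_norm_lt hr
    rw [hT]
    exact Ultrapower.norm_mk_le (hx.mono fun i hi =>
      (hM i _).trans (mul_le_mul_of_nonneg_left hi.le hM0))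
  have hlim : Tendsto (fun r : ℝ => M * r) (𝓝[>] ‖z‖) (𝓝 (M * ‖z‖)) :=
    (tendsto_nhdsWithin_of_tendsto_nhds tendsto_id).const_mul M
  exact ge_of_tendsto hlim (eventually_nhdsWithin_of_forall fun r hz => hr r hz)

/-- The bad maps `g (ν i)` induce an operator. If linear maps `t i` also induced it, unit vectors
where the two families differ by more than `1 / 2` would form a family on which the induced classes
disagree. -/
theorem approxK₀_lt_top_of_isUltraproductOfOperators (hU : CountablyIncomplete U)
    (h : ∀ T : Ultrapower U X →ₗ[ℝ] Ultrapower U Y, IsBoundedMap T → IsAccessible T →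
      IsUltraproductOfOperators T) : approxK₀ X Y < ⊤ := by
  by_contra hcon
  choose g hg hgd hgb hgl using exists_bounded_far_from_linear hcon
  obtain ⟨ν, hν⟩ := hU.exists_tendsto_atTop
  obtain ⟨T, hTb, hTi⟩ := exists_operator_of_asymptotically_linear (U := U)
    (G := fun i => g (ν i)) (fun i => hg _)
    (tendsto_one_div_add_atTop_nhds_zero_nat.comp hν) (fun i => hgd _) zero_le_two
    (fun i => hgb _)
  obtain ⟨t, -, ht⟩ := h T hTb ⟨_, hTi⟩
  have hsel : ∀ i, ∃ x : X, ‖x‖ = 1 ∧ 1 / 2 < ‖g (ν i) x - t i x‖ := by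
    intro i
    obtain ⟨x, hx⟩ := hgl (ν i) (t i)
    have hx0 : x ≠ 0 := by
      rintro rfl
      simp [(hg _).map_zero, norm_zero'] at hx
    have hp := norm_pos hx0
    refine ⟨‖x‖⁻¹ • x, norm_inv_smul hx0, ?_⟩
    rw [hg, map_smul, ← smul_sub, IsQuasinormed.smul, abs_of_pos (inv_pos.2 hp),
      lt_inv_mul_iff₀ hp]
    linarith
  choose x hx1 hx2 using hsel
  let fx : finiteFamilies U X := ⟨x, 1, Eventually.of_forall fun i => (hx1 i).le⟩
  obtain ⟨hgx, hTx⟩ := hTi fx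
  obtain ⟨htx, hTx'⟩ := ht fx
  have hlim := Ultrapower.mk_eq_mk_iff.1 (hTx.symm.trans hTx')
  obtain ⟨i, hi⟩ := (hlim.eventually_lt_const (by norm_num : (0 : ℝ) < 1 / 2)).exists
  exact absurd hi (not_lt.2 (hx2 i).le)

end Accessible

theorem mainTheorem5 {I : Type w} (U : Ultrafilter I) (hU : CountablyIncomplete U)
    (X Y : Type u) [AddCommGroup X] [Module ℝ X] [Norm X] [IsQuasiBanach X]
    [AddCommGroup Y] [Module ℝ Y] [Norm Y] [IsQuasiBanach Y]
    (hY : IsUltrasummand Y) (hXY : HasBAP X ∨ (IsKSpace X ∧ HasBAP Y)) :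
    List.TFAE [
      ∀ T : Ultrapower U X →ₗ[ℝ] Ultrapower U Y, IsBoundedMap T → IsAccessible T →
        IsUltraproductOfOperators T,
      approxK X Y < ⊤,
      approxK₀ X Y < ⊤,
      ∀ f : X → Y, IsQuasilinear f → IsTrivialMap f,
      EveryExtensionSplits X Y] := by
  tfae_have 1 → 3 := approxK₀_lt_top_of_isUltraproductOfOperators hU
  tfae_have 3 → 1 := isUltraproductOfOperators_of_approxK₀_lt_top
  tfae_have 3 → 2 := approxK_lt_top_of_approxK₀_lt_top hY hXY
  tfae_have 2 → 3 := approxK₀_le_approxK.trans_lt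
  tfae_have 2 → 4 := isTrivialMap_of_approxK_lt_top
  tfae_have 4 → 2 := approxK_lt_top_of_isTrivialMap hY
  tfae_have 4 → 5 := everyExtensionSplits_of_isTrivialMap
  tfae_have 5 → 4 := isTrivialMap_of_everyExtensionSplits
  tfae_finish
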